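/- **Lemma.** Let $K\ge 1$ and let $\mathcal A$ be a countable set of actions with $I_k:\mathcal A\to\{0,1\}$ (arm $k\in[K]$ is scheduled by $a$ iff $I_k(a)=1$). Let $S_1,S_2,\dots$ be i.i.d. network states, $X_k$ measurable and $\{0,1\}$-valued, $\overline x_k=\mathbb E[X_k(S_1)]$, $R_{k,t}=X_k(S_t)I_k(A_t)$ the reward of arm $k$ when action $A_t$ is played in slot $t\ge 1$. Let $\chi_k\in(0,1]$, $\gamma\in(0,1]$, $0<\varepsilon\le\gamma/2$, $\eta>0$, and assume Slater's condition: some probability mass function $\sigma$ on $\mathcal A$ satisfies $\overline x_k\sum_a\sigma(a)I_k(a)\ge\chi_k+\gamma$ for all $k$. *Virtual queues.* In each slot $t\ge1$ a delivery request is generated for arm $k$ with probability $\chi_k+\varepsilon$, independently over slots and arms and independently of $(S_t)_t$. Let $\tau_k(\ell)$ be the slot in which the $\ell$-th request ($\ell\ge1$) of arm $k$ is generated, let $\ell_{k,1}=1$, and let $\ell_{k,t+1}=\ell_{k,t}+1$ if $R_{k,t}=1$ and $\tau_k(\ell_{k,t})\le t$, and $\ell_{k,t+1}=\ell_{k,t}$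 otherwise (first come, first served). The head-of-line age is $Z_{k,t}=\max\{t-\tau_k(\ell_{k,t}),0\}$. *Age-based learning algorithm.* Let $N_{k,t}$ be the number of slots $s<t$ with $I_k(A_s)=1$, let $\widetilde x_{k,t}$ be the average of $R_{k,s}$ over these slots ($0$ if there are none), and let $U_{k,t}=\min\{1,\widetilde x_{k,t}+\sqrt{3\log t/(2N_{k,t})}\}$ if $N_{k,t}>0$, and $U_{k,t}=1$ if $N_{k,t}=0$. In each slot $t\ge 1$ the algorithm plays $$A_t\in\arg\max_{a\in\mathcal A}\sum_{k=1}^K(\eta U_{k,t}+Z_{k,t})I_k(a),$$ where $A_t$ is a measurable function of $(A_s,(R_{k,s})_k)_{s<t}$ and $(Z_{k,s})_{k,\,s\le t}$. Let $\overline x_{\min}=\min_k\overline x_k$ and, for $\mathbf y\in(0,1)^K$, $$h(\mathbf y)=-\frac{\overline x_{\min}}2\log\bigl(1-\min_k y_k\bigr),\quad g(\mathbf y,\theta)=\prod_{k=1}^K\frac{y_k e^{2\theta/\overline x_k}}{1-(1-y_k)e^{2\theta/\overline x_k}},$$ $$f(\mathbf y)=\min_{0<\theta\le h(\mathbf y)}\left[\frac{9\,g(\mathbf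 y,\theta)}{\theta^2}\log\left(\frac{32\,g(\mathbf y,\theta)}{\theta^2}\right)\right],$$ where $g(\mathbf y,\theta)=+\infty$, and so is the bracket, if a denominator vanishes (which is possible only at $\theta=h(\mathbf y)$). Let $$\widetilde L_t=\Bigl(\sum_{k=1}^K\frac{\chi_k+\varepsilon}{\overline x_k}Z_{k,t}^2\Bigr)^{1/2}.$$ Then the minimum defining $f((\chi_k)_k)$ is attained, and for every $t\ge1$ the variable $\widetilde L_t$ is integrable and $$\mathbb E[\widetilde L_t]\le\frac{8\log(4/\gamma)}{\gamma}\,f\bigl((\chi_k)_k\bigr)+\frac4\gamma\sum_{k=1}^K\frac1{\chi_k\overline x_k}+\frac{4K\eta}{\gamma}.$$ -/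

import Mathlib

open MeasureTheory ProbabilityTheory

noncomputable section

namespace AgeBandit

/-! Timeslots are the natural numbers `t ≥ 1`; the value of any process at index `0` is never used.
Arms are the elements of `Fin K`; `{0,1}`-valued quantities are `Bool`-valued. -/

/-! ### Sample paths of one virtual queue
`b t` says that a delivery request is generated at the beginning of slot `t`, and `r t` says that
slot `t` brings a real delivery for the arm. -/

/-- The slot `τ(ℓ)` in which the `ℓ`-th delivery request is generated: the first slot `s` by the end
of which at least `ℓ` requests were generated in the slots `1, …, s` (`⊤` if there is none).
In particular `τ(0) = 0`. -/
def arrivalSlot (b : ℕ → Bool) (ℓ : ℕ) : ℕ∞ :=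
  ⨅ (s : ℕ) (_ : ℓ ≤ ((Finset.Icc 1 s).filter (fun u => b u = true)).card), (s : ℕ∞)

open Classical in
/-- Index of the next-to-depart request at the beginning of slot `t`: one plus the index of the last
departed request. Service is first come first served, and the next-to-depart request departs in slot
`t` exactly if there is a real delivery in slot `t` and the request was generated by slot `t`. -/
def nextToDepart (b r : ℕ → Bool) : ℕ → ℕ
  | 0 => 1
  | 1 => 1
  | t + 2 => nextToDepart b r (t + 1) +
      (if r (t + 1) = true ∧ arrivalSlot b (nextToDepart b r (t + 1)) ≤ ((t + 1 : ℕ) : ℕ∞)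
        then 1 else 0)

/-- Head-of-line age `[t - τ(ℓ)]⁺`, where `ℓ` is the next-to-depart request in slot `t`
(subtraction in `ℕ∞` is truncated at `0`). -/
def headOfLineAge (b r : ℕ → Bool) (t : ℕ) : ℕ :=
  ((t : ℕ∞) - arrivalSlot b (nextToDepart b r t)).toNat

/-! ### UCB estimates of one arm
`i t` says that the arm is scheduled in slot `t`, and `r t` is its reward in slot `t`. -/

/-- `N_t`: number of slots before `t` in which the arm was scheduled. -/
def playCount (i : ℕ → Bool) : ℕ → ℕ
  | 0 => 0
  | 1 => 0
  | t + 2 => if i (t + 1) = true then playCount i (t + 1) + 1 else playCount i (t + 1)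

/-- The empirical mean reward of the arm at the beginning of slot `t`. -/
def empMean (i r : ℕ → Bool) : ℕ → ℝ
  | 0 => 0
  | 1 => 0
  | t + 2 =>
      if i (t + 1) = true then
        (1 / ((playCount i (t + 1) : ℝ) + 1)) *
          ((playCount i (t + 1) : ℝ) * empMean i r (t + 1) + ((r (t + 1)).toNat : ℝ))
      else empMean i r (t + 1)

/-- The UCB estimate `U_t` of the channel rate. -/
def ucb (i r : ℕ → Bool) (t : ℕ) : ℝ :=
  if playCount i t = 0 then 1
  else min 1 (empMean i r t + Real.sqrt (3 * Real.log t / (2 * (playCount i t : ℝ))))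

/-! ### The bandit model -/

section Model

variable {K : ℕ} {𝒮 𝒜 Ω : Type*}

/-- The reward `R_k(S_t, A_t) = X_k(S_t) I_k(A_t)` along the sample point `ω`. -/
def reward (X : Fin K → 𝒮 → Bool) (I : Fin K → 𝒜 → Bool) (S : ℕ → Ω → 𝒮) (A : ℕ → Ω → 𝒜)
    (k : Fin K) (ω : Ω) (t : ℕ) : Bool :=
  X k (S t ω) && I k (A t ω)

/-- The head-of-line age of arm `k` in slot `t`. -/
def age (X : Fin K → 𝒮 → Bool) (I : Fin K → 𝒜 → Bool) (S : ℕ → Ω → 𝒮) (B : Fin K → ℕ → Ω → Bool)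
    (A : ℕ → Ω → 𝒜) (k : Fin K) (t : ℕ) (ω : Ω) : ℕ :=
  headOfLineAge (fun s => B k s ω) (reward X I S A k ω) t

/-- The UCB estimate of the channel rate of arm `k` in slot `t`. -/
def ucbEstimate (X : Fin K → 𝒮 → Bool) (I : Fin K → 𝒜 → Bool) (S : ℕ → Ω → 𝒮) (A : ℕ → Ω → 𝒜)
    (k : Fin K) (t : ℕ) (ω : Ω) : ℝ :=
  ucb (fun s => I k (A s ω)) (reward X I S A k ω) t

/-- The sigma-algebra of the age-augmented history at the beginning of slot `t`: the actions and
rewards of the slots before `t` and the head-of-line ages of the slots up to `t`. -/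
def ageHistory [MeasurableSpace 𝒜] (X : Fin K → 𝒮 → Bool) (I : Fin K → 𝒜 → Bool) (S : ℕ → Ω → 𝒮)
    (B : Fin K → ℕ → Ω → Bool) (A : ℕ → Ω → 𝒜) (t : ℕ) : MeasurableSpace Ω :=
  (⨆ s ∈ Finset.Ico 1 t, MeasurableSpace.comap (A s) inferInstance) ⊔
  (⨆ k : Fin K, ⨆ s ∈ Finset.Ico 1 t,
    MeasurableSpace.comap (fun ω => reward X I S A k ω s) inferInstance) ⊔
  (⨆ k : Fin K, ⨆ s ∈ Finset.Icc 1 t,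
    MeasurableSpace.comap (age X I S B A k s) inferInstance)

/-- The quantity that the algorithm maximises over the actions `a` in slot `t`. -/
def score (X : Fin K → 𝒮 → Bool) (I : Fin K → 𝒜 → Bool) (S : ℕ → Ω → 𝒮) (B : Fin K → ℕ → Ω → Bool)
    (A : ℕ → Ω → 𝒜) (η : ℝ) (t : ℕ) (ω : Ω) (a : 𝒜) : ℝ :=
  ∑ k : Fin K, (η * ucbEstimate X I S A k t ω + (age X I S B A k t ω : ℝ)) * ((I k a).toNat : ℝ)

/-- The network states `S_1, S_2, …` are independent and identically distributed. -/
structure IsIIDNetwork [MeasurableSpace 𝒮] [MeasurableSpace Ω] (P : Measure Ω) (S : ℕ → Ω → 𝒮) :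
    Prop where
  measurable : ∀ t, 1 ≤ t → Measurable (S t)
  indep : iIndepFun (fun t : ℕ+ => S t) P
  identDistrib : ∀ t, 1 ≤ t → IdentDistrib (S t) (S 1) P P

/-- For each arm `k` and in each slot `t ≥ 1`, a delivery request is generated with probability
`p k`, independently over slots and arms. -/
structure IsRequestProcess [MeasurableSpace Ω] (P : Measure Ω) (p : Fin K → ℝ)
    (B : Fin K → ℕ → Ω → Bool) : Prop where
  measurable : ∀ k t, 1 ≤ t → Measurable (B k t)
  indep : iIndepFun (fun q : Fin K × ℕ+ => B q.1 q.2) P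
  prob : ∀ k t, 1 ≤ t → P.real {ω | B k t ω = true} = p k

/-- The actions `A_1, A_2, …` are played by the age-based learning algorithm: each action is a
measurable function of the age-augmented history and maximises the score (ties are broken in any
such way). -/
structure IsAgeBasedLearning [MeasurableSpace 𝒜] (X : Fin K → 𝒮 → Bool) (I : Fin K → 𝒜 → Bool)
    (S : ℕ → Ω → 𝒮) (B : Fin K → ℕ → Ω → Bool) (η : ℝ) (A : ℕ → Ω → 𝒜) : Prop where
  ageBased : ∀ t, 1 ≤ t → Measurable[ageHistory X I S B A t] (A t)
  argmax : ∀ t, 1 ≤ t → ∀ ω, ∀ a : 𝒜, score X I S B A η t ω a ≤ score X I S B A η t ω (A t ω)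

/-- The channel rate `E[X_k(S_1)]` of arm `k`. -/
def channelRate [MeasurableSpace Ω] (P : Measure Ω) (X : Fin K → 𝒮 → Bool) (S : ℕ → Ω → 𝒮)
    (k : Fin K) : ℝ :=
  ∫ ω, ((X k (S 1 ω)).toNat : ℝ) ∂P

/-- Slater's condition for the static policy `σ`: it is `γ`-tight for the throughput requirements
`χ` under the channel rates `xbar`. -/
def IsTight (I : Fin K → 𝒜 → Bool) (xbar χ : Fin K → ℝ) (γ : ℝ) (σ : PMF 𝒜) : Prop :=
  ∀ k, χ k + γ ≤ xbar k * ∑' a, (σ a).toReal * ((I k a).toNat : ℝ)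

/-- Euclidean norm of the head-of-line ages with the weights `√((χ_k + ε) / xbar_k)`. -/
def weightedAgeNorm (X : Fin K → 𝒮 → Bool) (I : Fin K → 𝒜 → Bool) (S : ℕ → Ω → 𝒮)
    (B : Fin K → ℕ → Ω → Bool) (A : ℕ → Ω → 𝒜) (xbar χ : Fin K → ℝ) (ε : ℝ) (t : ℕ) (ω : Ω) : ℝ :=
  ‖(WithLp.toLp 2 (fun k : Fin K =>
      Real.sqrt ((χ k + ε) / xbar k) * (age X I S B A k t ω : ℝ)) : EuclideanSpace ℝ (Fin K))‖

end Model

/-! ### The function `f` -/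

section Bound

variable {K : ℕ}

/-- `h(y) = -(xbar_min / 2) log (1 - min_k y_k)`. -/
def hBound [NeZero K] (xbar y : Fin K → ℝ) : ℝ :=
  -(Finset.univ.inf' Finset.univ_nonempty xbar / 2) *
    Real.log (1 - Finset.univ.inf' Finset.univ_nonempty y)

/-- `g(y, θ)`, a product of moment generating functions of geometric laws. -/
def gProd (xbar y : Fin K → ℝ) (θ : ℝ) : ℝ :=
  ∏ k, y k * Real.exp (2 * θ / xbar k) / (1 - (1 - y k) * Real.exp (2 * θ / xbar k))

/-- The `θ ∈ (0, h(y)]` at which `g(y, θ)` is finite. For `y` in `(0,1)^K` and positive `xbar` this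
excludes at most the end point `θ = h(y)`, at which a denominator of `g` can vanish; the expression
that is minimised is then `+∞`, and such a `θ` does not count for the minimum. -/
def thetaRange [NeZero K] (xbar y : Fin K → ℝ) : Set ℝ :=
  {θ | 0 < θ ∧ θ ≤ hBound xbar y ∧ ∀ k, (1 - y k) * Real.exp (2 * θ / xbar k) < 1}

/-- The expression that is minimised over `θ`. -/
def fObjective (xbar y : Fin K → ℝ) (θ : ℝ) : ℝ :=
  9 * gProd xbar y θ / θ ^ 2 * Real.log (32 * gProd xbar y θ / θ ^ 2)

/-- `f(y)`, the minimum of the objective over `θ`. -/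
def fBound [NeZero K] (xbar y : Fin K → ℝ) : ℝ :=
  sInf (fObjective xbar y '' thetaRange xbar y)

end Bound

end AgeBandit

end

noncomputable section

namespace AgeBandit

/-! ### Sample paths -/

/-! The bound is a Lyapunov drift estimate in exponential form. The UCB estimates enter only through
their range [0, 1] (`ucb_mem_Icc`): replacing the maximising action by the average over the Slater
policy costs at most Kη (`sum_age_mul_scheduleRate_le`), so no concentration inequality is needed.

The main difficulty is to find independence in one transition of the ages. When the head-of-line
request of arm k has age z_k in slot t, the history has looked at the requests of that arm only up
to slot t - z_k. The waiting time from there to the next request is therefore fresh, and a delivery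
lowers the age by this geometric time, truncated (`headOfLineAge_succ`). Precisely, the event that
slot t shows given ages and a given set of scheduled arms depends on the states before t and the
requests up to the slots t - z_k (`determinedBy_snapshot_eq`), whereas the upper bound `nextAge` for
the following ages depends on the state of slot t and on later requests. These two blocks of noise
are disjoint, and `integral_le_integral_snapshot` turns this into conditioning on finitely many
values.

Write p = χ + ε and let L be the weighted norm of the ages. Geometric second moments and Slater's
condition give L² a drift of at most -γL plus a constant, so L itself drifts by at most -γ/4 above
`driftLevel` (`integral_weightedNorm_nextAge_sub_le`). The increment of L is at most a weighted sum
of independent truncated geometric times, and its exponential moment is at most g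
(`integral_exp_nextAge_le`). With r = `lyapunovRate`, a second-order expansion makes exp(rL)
contract by 1 - rγ/8, up to an additive constant (`integral_exp_weightedNorm_nextAge_le`). Iterating
from L = 0 in slot 1 and applying Jensen's inequality bounds E[L] by `driftLevel` plus a logarithm
divided by r. That quotient is compared with the objective of f at the same θ
(`log_div_lyapunovRate_le`), and a minimising θ is chosen; it exists by compactness
(`isLeast_fBound`). -/

/-- Number of requests generated in the slots `1, …, s`. -/
def requestCount (b : ℕ → Bool) (s : ℕ) : ℕ := ((Finset.Icc 1 s).filter (fun u => b u = true)).card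

lemma requestCount_zero (b : ℕ → Bool) : requestCount b 0 = 0 := by simp [requestCount]

lemma requestCount_succ (b : ℕ → Bool) (s : ℕ) :
    requestCount b (s + 1) = requestCount b s + if b (s + 1) = true then 1 else 0 := by
  unfold requestCount
  rw [← Finset.insert_Icc_right_eq_Icc_add_one (by omega), Finset.filter_insert]
  split_ifs with h
  · rw [Finset.card_insert_of_notMem (by simp)]
  · simp

lemma requestCount_mono (b : ℕ → Bool) : Monotone (requestCount b) :=
  monotone_nat_of_le_succ fun s => by rw [requestCount_succ]; omega

lemma arrivalSlot_le_iff (b : ℕ → Bool) (l s : ℕ) :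
    arrivalSlot b l ≤ (s : ℕ∞) ↔ l ≤ requestCount b s := by
  constructor
  · intro h
    by_contra hlt
    have : ((s + 1 : ℕ) : ℕ∞) ≤ arrivalSlot b l := by
      refine le_iInf₂ fun u hu => ?_
      have : ¬ u ≤ s := fun hus => hlt (le_trans hu (requestCount_mono b hus))
      exact_mod_cast (by omega : s + 1 ≤ u)
    have := le_trans this h
    norm_cast at this
    omega
  · intro h
    exact iInf₂_le (f := fun (u : ℕ) (_ : l ≤ requestCount b u) => (u : ℕ∞)) s h

lemma nextToDepart_succ (b r : ℕ → Bool) {t : ℕ} (ht : 1 ≤ t) :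
    nextToDepart b r (t + 1) = nextToDepart b r t +
      if r t = true ∧ nextToDepart b r t ≤ requestCount b t then 1 else 0 := by
  classical
  obtain ⟨t, rfl⟩ := Nat.exists_eq_add_of_le' ht
  rw [nextToDepart]
  simp only [arrivalSlot_le_iff]

lemma nextToDepart_bounds (b r : ℕ → Bool) {t : ℕ} (ht : 1 ≤ t) :
    1 ≤ nextToDepart b r t ∧ nextToDepart b r t ≤ requestCount b (t - 1) + 1 := by
  induction t, ht using Nat.le_induction with
  | base => simp [nextToDepart]
  | succ t ht ih =>
    rw [nextToDepart_succ b r ht]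
    have := requestCount_mono b (Nat.sub_le t 1)
    simp only [Nat.add_sub_cancel]
    split_ifs with h <;> omega

/-- The age is at least t - u exactly if the head-of-line request was generated by slot u. Ages thus
become inequalities between request counts. The case u = t is excluded because truncation at 0 makes
the left side trivial there. -/
lemma le_headOfLineAge_iff (b r : ℕ → Bool) {t u : ℕ} (h : u < t) :
    t - u ≤ headOfLineAge b r t ↔ nextToDepart b r t ≤ requestCount b u := by
  rw [← arrivalSlot_le_iff, headOfLineAge]
  cases hτ : arrivalSlot b (nextToDepart b r t) with
  | top => simp; omega
  | coe n =>
    rw [← ENat.natCast_sub, ENat.toNat_natCast, Nat.cast_le]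
    omega

/-- The waiting time from slot `m` to the next slot with a request, truncated at `n`. -/
def waitTime (b : ℕ → Bool) : ℕ → ℕ → ℕ
  | _, 0 => 0
  | m, n + 1 => 1 + if b (m + 1) = true then 0 else waitTime b (m + 1) n

lemma waitTime_le (b : ℕ → Bool) (m n : ℕ) : waitTime b m n ≤ n := by
  induction n generalizing m with
  | zero => simp [waitTime]
  | succ n ih =>
    have := ih (m + 1)
    rw [waitTime]; split_ifs <;> omega

lemma one_le_waitTime (b : ℕ → Bool) (m n : ℕ) : 1 ≤ waitTime b m (n + 1) := by
  rw [waitTime]; omega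

/-- The bound u < m + n keeps the comparison below the truncation level, where the truncated and the
true waiting time agree. -/
lemma waitTime_le_iff (b : ℕ → Bool) {m n u : ℕ} (hm : m ≤ u) (hu : u < m + n) :
    waitTime b m n ≤ u - m ↔ requestCount b m + 1 ≤ requestCount b u := by
  induction n generalizing m with
  | zero => omega
  | succ n ih =>
    rw [waitTime]
    rcases hm.eq_or_lt with rfl | hm
    · omega
    · have h1 := requestCount_succ b m
      have h2 := requestCount_mono b (show m + 1 ≤ u by omega)
      split_ifs at h1 ⊢ with hb
      · omega
      · have := ih (m := m + 1) (by omega) (by omega)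
        omega

lemma waitTime_congr {b b' : ℕ → Bool} {m n : ℕ}
    (h : ∀ u, m < u → u ≤ m + waitTime b m n → b u = b' u) :
    waitTime b m n = waitTime b' m n := by
  induction n generalizing m with
  | zero => simp [waitTime]
  | succ n ih =>
    have h1 := h (m + 1) (by omega) (by have := one_le_waitTime b m n; omega)
    rw [waitTime] at h
    rw [waitTime, waitTime, ← h1]
    split_ifs at h ⊢ with hb
    · rfl
    · rw [ih fun u hu hu' => h u (by omega) (by omega)]

lemma headOfLineAge_one (b r : ℕ → Bool) : headOfLineAge b r 1 = 0 := by
  have := le_headOfLineAge_iff b r (t := 1) (u := 0) (by omega)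
  simp [requestCount_zero, nextToDepart] at this
  exact this

lemma headOfLineAge_lt (b r : ℕ → Bool) {t : ℕ} (ht : 1 ≤ t) : headOfLineAge b r t < t := by
  have := le_headOfLineAge_iff b r (t := t) (u := 0) (by omega)
  have h1 := nextToDepart_bounds b r ht
  rw [requestCount_zero] at this
  omega

/-- The head-of-line age follows a recursion in terms of the waiting time for the next request. -/
lemma headOfLineAge_succ (b r : ℕ → Bool) {t : ℕ} (ht : 1 ≤ t) :
    headOfLineAge b r (t + 1) =
      if headOfLineAge b r t = 0 then (if r t = false ∧ b t = true then 1 else 0)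
      else if r t = true then headOfLineAge b r t + 1 -
          waitTime b (t - headOfLineAge b r t) (headOfLineAge b r t + 1)
      else headOfLineAge b r t + 1 := by
  obtain ⟨t, rfl⟩ := Nat.exists_eq_add_of_le' ht
  have hlt := headOfLineAge_lt b r ht
  have hl := nextToDepart_bounds b r ht
  have hs := nextToDepart_succ b r ht
  have H := fun u hu => le_headOfLineAge_iff b r (t := t + 1) (u := u) hu
  have H' := fun u hu => le_headOfLineAge_iff b r (t := t + 1 + 1) (u := u) hu
  set z := headOfLineAge b r (t + 1) with hz
  set z' := headOfLineAge b r (t + 1 + 1) with hz'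
  set l := nextToDepart b r (t + 1) with hlr
  set l' := nextToDepart b r (t + 1 + 1) with hlr'
  clear_value z z' l l'
  simp only [Nat.add_sub_cancel] at hl
  by_cases h0 : z = 0
  · have e1 := H t (by omega)
    have e2 := requestCount_succ b t
    have e3 := H' (t + 1) (by omega)
    have e4 := H' t (by omega)
    rw [if_pos h0]
    cases hr : r (t + 1) <;> cases hb : b (t + 1) <;> simp [hr, hb] at hs e2 ⊢ <;>
      first
      | omega
      | (split_ifs at hs <;> omega)
  -- The slot m + 1 is the one in which the head-of-line request was generated.
  · obtain ⟨m, hm⟩ : ∃ m, t + 1 - z = m + 1 := ⟨t - z, by omega⟩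
    have e1 := H (m + 1) (by omega)
    have e2 := H m (by omega)
    have e3 := requestCount_succ b m
    have e4 := requestCount_mono b (show m + 1 ≤ t + 1 by omega)
    have e5 := H' m (by omega)
    rw [if_neg h0]
    cases hr : r (t + 1)
    · simp [hr] at hs ⊢
      have e6 := H' (m + 1) (by omega)
      omega
    -- At most one request arrives per slot, so the departing request is the last one generated by
    -- slot m + 1.
    · have hl' : l' = requestCount b (m + 1) + 1 := by
        rw [hs, if_pos ⟨hr, by omega⟩]
        split_ifs at e3 <;> omega
      rw [if_pos rfl, hm]
      have hW := waitTime_le b (m + 1) (z + 1)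
      have hW1 := one_le_waitTime b (m + 1) z
      -- Comparing both sides with every threshold j identifies the new age as z + 1 minus the
      -- waiting time.
      have key : ∀ j, 1 ≤ j → j ≤ z + 1 → (j ≤ z' ↔ waitTime b (m + 1) (z + 1) ≤ z + 1 - j) := by
        intro j hj1 hj2
        have f1 := H' (t + 1 + 1 - j) (by omega)
        have f2 := waitTime_le_iff b (m := m + 1) (n := z + 1) (u := t + 1 + 1 - j)
          (by omega) (by omega)
        rw [← hl', ← f1] at f2
        rw [show t + 1 + 1 - (t + 1 + 1 - j) = j by omega,
          show t + 1 + 1 - j - (m + 1) = z + 1 - j by omega] at f2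
        exact f2.symm
      generalize waitTime b (m + 1) (z + 1) = W at *
      have hz1 : z' ≤ z + 1 := by
        split_ifs at e3 <;> omega
      have k1 := key z'
      have k2 := key (z + 1 - W)
      omega

lemma headOfLineAge_succ_le (b r : ℕ → Bool) {t : ℕ} (ht : 1 ≤ t) :
    headOfLineAge b r (t + 1) ≤ headOfLineAge b r t + 1 -
      (r t).toNat * waitTime b (t - headOfLineAge b r t) (headOfLineAge b r t + 1) := by
  rw [headOfLineAge_succ b r ht]
  have := waitTime_le b (t - headOfLineAge b r t) (headOfLineAge b r t + 1)
  cases h : r t <;> simp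
  · split_ifs <;> omega
  · split_ifs <;> omega

/-- The recursion inspects requests only up to the slot in which the next waiting time ends, which
is the slot t + 1 minus the new age. Later requests have no influence on the new age. -/
lemma headOfLineAge_succ_congr {b b' r r' : ℕ → Bool} {t : ℕ} (ht : 1 ≤ t)
    (hz : headOfLineAge b r t = headOfLineAge b' r' t) (hr : r t = r' t)
    (hb : ∀ u, 1 ≤ u → u ≤ t + 1 - headOfLineAge b r (t + 1) → b u = b' u) :
    headOfLineAge b r (t + 1) = headOfLineAge b' r' (t + 1) := by
  have hlt := headOfLineAge_lt b r ht
  rw [headOfLineAge_succ b' r' ht, headOfLineAge_succ b r ht, ← hz, ← hr]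
  rw [headOfLineAge_succ b r ht] at hb
  split_ifs at hb ⊢ <;> first | rfl | skip
  all_goals first
    | (rw [waitTime_congr (b' := b')]
       intro u hu1 hu2
       exact hb u (by omega)
         (by have := waitTime_le b (t - headOfLineAge b r t) (headOfLineAge b r t + 1); omega))
    | (have := hb t (by omega) (by omega); simp_all)

lemma headOfLineAge_succ_le_add_one (b r : ℕ → Bool) {t : ℕ} (ht : 1 ≤ t) :
    headOfLineAge b r (t + 1) ≤ headOfLineAge b r t + 1 :=
  (headOfLineAge_succ_le b r ht).trans (Nat.sub_le _ _)

/-! ### UCB estimates -/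

lemma empMean_nonneg (i r : ℕ → Bool) (t : ℕ) : 0 ≤ empMean i r t := by
  induction t using Nat.strong_induction_on with
  | _ t ih =>
    match t with
    | 0 => simp [empMean]
    | 1 => simp [empMean]
    | t + 2 =>
      have := ih (t + 1) (by omega)
      rw [empMean]
      split_ifs <;> positivity

/-- The only property of the learning estimates that the bound needs. -/
lemma ucb_mem_Icc (i r : ℕ → Bool) (t : ℕ) : ucb i r t ∈ Set.Icc (0 : ℝ) 1 := by
  unfold ucb
  split_ifs
  · simp
  · exact ⟨le_min zero_le_one (add_nonneg (empMean_nonneg i r t) (Real.sqrt_nonneg _)),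
      min_le_left _ _⟩

/-! ### Random variables determined by finitely many members of an independent family -/

section Determined

variable {ι β γ Ω : Type*}

/-- The values of the variables `W j` with `j ∈ J` determine the value of `f`. -/
def DeterminedBy (W : ι → Ω → β) (J : Finset ι) (f : Ω → γ) : Prop :=
  ∀ ω ω', (∀ j ∈ J, W j ω = W j ω') → f ω = f ω'

namespace DeterminedBy

variable {W : ι → Ω → β} {J J' : Finset ι} {f : Ω → γ}

lemma mono (h : DeterminedBy W J f) (hJ : J ⊆ J') : DeterminedBy W J' f :=
  fun ω ω' hω => h ω ω' fun j hj => hω j (hJ hj)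

lemma comp {δ : Type*} (h : DeterminedBy W J f) (g : γ → δ) :
    DeterminedBy W J (fun ω => g (f ω)) :=
  fun ω ω' hω => congrArg g (h ω ω' hω)

lemma comp₂ {γ' δ : Type*} {f' : Ω → γ'} (h : DeterminedBy W J f) (h' : DeterminedBy W J f')
    (g : γ → γ' → δ) : DeterminedBy W J (fun ω => g (f ω) (f' ω)) :=
  fun ω ω' hω => congrArg₂ g (h ω ω' hω) (h' ω ω' hω)

lemma of_forall {κ : Type*} {f : κ → Ω → γ} (h : ∀ k, DeterminedBy W J (f k)) :
    DeterminedBy W J (fun ω k => f k ω) :=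
  fun ω ω' hω => funext fun k => h k ω ω' hω

lemma exists_eq [Nonempty γ] (h : DeterminedBy W J f) :
    ∃ g : (J → β) → γ, f = fun ω => g (fun j : J => W j ω) := by
  have : Function.FactorsThrough f (fun ω (j : J) => W j ω) := fun ω ω' hω =>
    h ω ω' fun j hj => congrFun hω ⟨j, hj⟩
  obtain ⟨g, hg⟩ := (Function.factorsThrough_iff f).1 this
  exact ⟨g, hg⟩

variable [Finite β] [MeasurableSpace β] [MeasurableSingletonClass β] [MeasurableSpace Ω]

/-- The function factors through a finite product of finite types, on which every map is measurable;
for real values it is also bounded, whence `integrable`. -/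
lemma measurable [Nonempty γ] [MeasurableSpace γ] (h : DeterminedBy W J f)
    (hW : ∀ j, Measurable (W j)) : Measurable f := by
  obtain ⟨g, rfl⟩ := h.exists_eq
  exact (measurable_of_finite g).comp (measurable_pi_lambda _ fun j => hW j)

lemma integrable {P : Measure Ω} [IsFiniteMeasure P] {f : Ω → ℝ} (h : DeterminedBy W J f)
    (hW : ∀ j, Measurable (W j)) : Integrable f P := by
  have hm := h.measurable hW
  obtain ⟨g, rfl⟩ := h.exists_eq
  obtain ⟨C, hC⟩ := (Set.finite_range g).isBounded.exists_norm_le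
  exact Integrable.of_bound hm.aestronglyMeasurable C
    (Filter.Eventually.of_forall fun ω => hC _ ⟨_, rfl⟩)

lemma integral_mul {P : Measure Ω} {f f' : Ω → ℝ} (h : DeterminedBy W J f)
    (h' : DeterminedBy W J' f') (hJ : Disjoint J J') (hW : ∀ j, Measurable (W j))
    (hind : iIndepFun W P) : ∫ ω, f ω * f' ω ∂P = (∫ ω, f ω ∂P) * ∫ ω, f' ω ∂P := by
  have hm := h.measurable hW
  have hm' := h'.measurable hW
  obtain ⟨g, rfl⟩ := h.exists_eq
  obtain ⟨g', rfl⟩ := h'.exists_eq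
  have := (hind.indepFun_finset J J' hJ hW).comp (measurable_of_finite g) (measurable_of_finite g')
  exact this.integral_fun_mul_eq_mul_integral hm.aestronglyMeasurable hm'.aestronglyMeasurable

lemma integral_prod {P : Measure Ω} [IsProbabilityMeasure P] {κ : Type*} {J : κ → Finset ι}
    {f : κ → Ω → ℝ} (h : ∀ k, DeterminedBy W (J k) (f k))
    (hJ : Pairwise fun k l => Disjoint (J k) (J l)) (hW : ∀ j, Measurable (W j))
    (hind : iIndepFun W P) (s : Finset κ) :
    ∫ ω, ∏ k ∈ s, f k ω ∂P = ∏ k ∈ s, ∫ ω, f k ω ∂P := by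
  classical
  induction s using Finset.induction_on with
  | empty => simp
  | insert k s hk ih =>
    simp only [Finset.prod_insert hk]
    rw [← ih]
    refine (h k).integral_mul (J' := s.biUnion J) ?_ ?_ hW hind
    · intro ω ω' hω
      refine Finset.prod_congr rfl fun l hl => h l ω ω' fun j hj => hω j ?_
      exact Finset.mem_biUnion.2 ⟨l, hl, hj⟩
    · refine (Finset.disjoint_biUnion_right _ _ _).2 fun l hl => hJ ?_
      rintro rfl
      exact hk hl

end DeterminedBy

end Determined

/-! ### The driving noise -/

section Noise

variable {K : ℕ} {𝒮 Ω : Type*}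

/-- The channel states of all arms in the slots `t`, and the requests of arm `k` in slot `u`, as one
family of random variables. -/
def noise (X : Fin K → 𝒮 → Bool) (S : ℕ → Ω → 𝒮) (B : Fin K → ℕ → Ω → Bool) :
    ℕ+ ⊕ (Fin K × ℕ+) → Ω → Fin K → Bool
  | .inl t => fun ω k => X k (S t ω)
  | .inr q => fun ω _ => B q.1 q.2 ω

variable [MeasurableSpace 𝒮] [MeasurableSpace Ω] {P : Measure Ω} {X : Fin K → 𝒮 → Bool}
  {S : ℕ → Ω → 𝒮} {B : Fin K → ℕ → Ω → Bool} {p : Fin K → ℝ}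

lemma measurable_noise (hX : ∀ k, Measurable (X k)) (hS : IsIIDNetwork P S)
    (hB : IsRequestProcess P p B) : ∀ j, Measurable (noise X S B j)
  | .inl t => measurable_pi_lambda _ fun k => (hX k).comp (hS.measurable t t.pos)
  | .inr q => measurable_pi_lambda _ fun _ => hB.measurable q.1 q.2 q.2.pos

/-- Each of the two families is independent and the families are independent of each other, so a
finite index set can be split into its two halves. The channel states of all arms in one slot form a
single member, since they may depend on each other. -/
lemma iIndepFun_noise (hX : ∀ k, Measurable (X k)) (hS : IsIIDNetwork P S)
    (hB : IsRequestProcess P p B)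
    (hSB : IndepFun (fun ω (t : ℕ+) => S t ω) (fun ω (q : Fin K × ℕ+) => B q.1 q.2 ω) P) :
    iIndepFun (noise X S B) P := by
  have h1 : iIndepFun (fun t : ℕ+ => noise X S B (.inl t)) P :=
    hS.indep.comp (fun _ s k => X k s) fun _ => measurable_pi_lambda _ hX
  have h2 : iIndepFun (fun q : Fin K × ℕ+ => noise X S B (.inr q)) P :=
    hB.indep.comp (fun _ b _ => b) fun _ => measurable_pi_lambda _ fun _ => measurable_id
  have h3 : IndepFun (fun ω (t : ℕ+) => noise X S B (.inl t) ω)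
      (fun ω (q : Fin K × ℕ+) => noise X S B (.inr q) ω) P := by
    have hφ : Measurable fun (s : ℕ+ → 𝒮) (t : ℕ+) (k : Fin K) => X k (s t) :=
      measurable_pi_lambda _ fun t => measurable_pi_lambda _ fun k =>
        (hX k).comp (measurable_pi_apply t)
    have hψ : Measurable fun (b : Fin K × ℕ+ → Bool) q (_ : Fin K) => b q :=
      measurable_pi_lambda _ fun q => measurable_pi_lambda _ fun _ => measurable_pi_apply q
    exact hSB.comp hφ hψ
  rw [iIndepFun_iff_measure_inter_preimage_eq_mul] at h1 h2 ⊢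
  rw [indepFun_iff_measure_inter_preimage_eq_mul] at h3
  intro J sets hsets
  have e1 := h1 J.toLeft (sets := fun t => sets (.inl t)) fun t ht =>
    hsets _ (Finset.mem_toLeft.1 ht)
  have e2 := h2 J.toRight (sets := fun q => sets (.inr q)) fun t ht =>
    hsets _ (Finset.mem_toRight.1 ht)
  have e3 := h3 (⋂ t ∈ J.toLeft, (fun s => s t) ⁻¹' sets (.inl t))
    (⋂ q ∈ J.toRight, (fun b => b q) ⁻¹' sets (.inr q))
    (Finset.measurableSet_biInter _ fun t ht =>
      measurable_pi_apply t (hsets _ (Finset.mem_toLeft.1 ht)))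
    (Finset.measurableSet_biInter _ fun t ht =>
      measurable_pi_apply t (hsets _ (Finset.mem_toRight.1 ht)))
  simp only [Set.preimage_iInter, ← Set.preimage_comp] at e3
  rw [← Finset.toLeft_disjSum_toRight (u := J), Finset.prod_disjSum, ← e1, ← e2]
  refine Eq.trans ?_ e3
  congr 1
  ext ω
  simp only [Set.mem_iInter, Set.mem_inter_iff, Finset.mem_disjSum, Set.mem_preimage,
    Function.comp]
  constructor
  · intro h
    exact ⟨fun t ht => h _ (.inl ⟨t, ht, rfl⟩), fun t ht => h _ (.inr ⟨t, ht, rfl⟩)⟩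
  · rintro ⟨ha, hb⟩ _ (⟨t, ht, rfl⟩ | ⟨t, ht, rfl⟩)
    exacts [ha t ht, hb t ht]

end Noise

/-! ### What the age-augmented history reveals -/

section History

variable {K : ℕ} {𝒮 𝒜 Ω : Type*} [MeasurableSpace 𝒜] {X : Fin K → 𝒮 → Bool} {I : Fin K → 𝒜 → Bool}
  {S : ℕ → Ω → 𝒮} {B : Fin K → ℕ → Ω → Bool} {A : ℕ → Ω → 𝒜} {η : ℝ}

/-- Two sample points with the same age-augmented history up to slot `t` are not separated by the
sigma-algebra of this history. -/
lemma mem_iff_mem_of_ageHistory {t : ℕ} {ω ω' : Ω}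
    (hact : ∀ s ∈ Finset.Ico 1 t, A s ω = A s ω')
    (hrew : ∀ k, ∀ s ∈ Finset.Ico 1 t, reward X I S A k ω s = reward X I S A k ω' s)
    (hage : ∀ k, ∀ s ∈ Finset.Icc 1 t, age X I S B A k s ω = age X I S B A k s ω')
    {E : Set Ω} (hE : MeasurableSet[ageHistory X I S B A t] E) : ω ∈ E ↔ ω' ∈ E := by
  -- The sets that do not separate the two points form a sigma-algebra, so it suffices to check
  -- generators.
  let M : MeasurableSpace Ω :=
    { MeasurableSet' := fun E => ω ∈ E ↔ ω' ∈ E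
      measurableSet_empty := by simp
      measurableSet_compl := fun E hE => not_congr hE
      measurableSet_iUnion := fun E hE => by simp only [Set.mem_iUnion, hE] }
  have key : ∀ {β : Type _} (mβ : MeasurableSpace β) (f : Ω → β), f ω = f ω' →
      MeasurableSpace.comap f mβ ≤ M := by
    rintro β mβ f hf _ ⟨s, -, rfl⟩
    change f ω ∈ s ↔ f ω' ∈ s
    rw [hf]
  have key' : ∀ (f : Ω → 𝒜), f ω = f ω' → MeasurableSpace.comap f inferInstance ≤ M := by
    rintro f hf _ ⟨s, -, rfl⟩
    change f ω ∈ s ↔ f ω' ∈ s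
    rw [hf]
  have hle : ageHistory X I S B A t ≤ M := by
    refine sup_le (sup_le ?_ ?_) ?_
    · exact iSup₂_le fun s hs => key' _ (hact s hs)
    · exact iSup_le fun k => iSup₂_le fun s hs => key _ _ (hrew k s hs)
    · exact iSup_le fun k => iSup₂_le fun s hs => key _ _ (hage k s hs)
  exact hle E hE

variable [MeasurableSingletonClass 𝒜]

/-- The actions and the ages up to slot `t` are functions of the states of the earlier slots and of
the requests generated up to the head-of-line requests of slot `t`. -/
lemma history_congr (hA : IsAgeBasedLearning X I S B η A) {t : ℕ} (ht : 1 ≤ t) {ω ω' : Ω}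
    (hS : ∀ k s, 1 ≤ s → s < t → X k (S s ω) = X k (S s ω'))
    (hB : ∀ k u, 1 ≤ u → u ≤ t - age X I S B A k t ω → B k u ω = B k u ω') {s : ℕ}
    (hs : 1 ≤ s) (hst : s ≤ t) :
    A s ω = A s ω' ∧ ∀ k, age X I S B A k s ω = age X I S B A k s ω' := by
  induction t, ht using Nat.le_induction generalizing s with
  | base =>
    obtain rfl : s = 1 := le_antisymm hst hs
    have hage : ∀ k, age X I S B A k 1 ω = age X I S B A k 1 ω' := fun k => by
      simp only [age, headOfLineAge_one]
    refine ⟨?_, hage⟩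
    -- The event of playing the action chosen at ω is in the history sigma-algebra, hence does not
    -- separate ω from ω'.
    have := hA.ageBased 1 le_rfl (MeasurableSet.singleton (A 1 ω))
    refine ((mem_iff_mem_of_ageHistory (ω' := ω') (by simp) (by simp) ?_ this).1 rfl).symm
    intro k s hs
    obtain rfl : s = 1 := by simpa using hs
    exact hage k
  | succ t ht ih =>
    -- An age grows by at most one per slot, so the slot t minus the age never decreases: the
    -- requests assumed to agree at t + 1 include those required at t.
    have IH := fun {s} hs hst => ih (fun k s h1 h2 => hS k s h1 (by omega))
      (fun k u h1 h2 => hB k u h1 (by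
        have : age X I S B A k (t + 1) ω ≤ age X I S B A k t ω + 1 := headOfLineAge_succ_le_add_one _ _ ht
        omega)) (s := s) hs hst
    rcases hst.lt_or_eq with hlt | rfl
    · exact IH hs (by omega)
    have hrew : ∀ k, ∀ s, 1 ≤ s → s ≤ t → reward X I S A k ω s = reward X I S A k ω' s := by
      intro k s h1 h2
      simp only [reward, (IH h1 h2).1, hS k s h1 (by omega)]
    have hage : ∀ k, age X I S B A k (t + 1) ω = age X I S B A k (t + 1) ω' := fun k =>
      headOfLineAge_succ_congr ht ((IH ht le_rfl).2 k) (hrew k t ht le_rfl) (hB k)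
    refine ⟨?_, hage⟩
    have := hA.ageBased (t + 1) (by omega) (MeasurableSet.singleton (A (t + 1) ω))
    refine ((mem_iff_mem_of_ageHistory (ω' := ω') ?_ ?_ ?_ this).1 rfl).symm
    · intro s hs
      rw [Finset.mem_Ico] at hs
      exact (IH hs.1 (by omega)).1
    · intro k s hs
      rw [Finset.mem_Ico] at hs
      exact hrew k s hs.1 (by omega)
    · intro k s hs
      rw [Finset.mem_Icc] at hs
      rcases hs.2.lt_or_eq with hlt | rfl
      · exact (IH hs.1 (by omega)).2 k
      · exact hage k

end History

/-! ### Disjoint blocks of noise -/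

section Blocks

variable {K : ℕ}

/-- The timeslots `1, …, n - 1`. -/
def slots (n : ℕ) : Finset ℕ+ := (Finset.range n).subtype (0 < ·)

lemma mem_slots {n : ℕ} {t : ℕ+} : t ∈ slots n ↔ (t : ℕ) < n := by
  exact Finset.mem_subtype.trans Finset.mem_range

/-- The noise consisting of the states before slot `t` and the requests of arm `k` in the slots up
to `min t (m k)`. -/
def pastNoise (t : ℕ) (m : Fin K → ℕ) : Finset (ℕ+ ⊕ (Fin K × ℕ+)) :=
  (slots t).disjSum ((Finset.univ ×ˢ slots (t + 1)).filter fun q => (q.2 : ℕ) ≤ m q.1)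

/-- The noise consisting of the requests of arm `k` in the slots `m + 1, …, n`. -/
def armNoise (k : Fin K) (m n : ℕ) : Finset (ℕ+ ⊕ (Fin K × ℕ+)) :=
  (∅ : Finset ℕ+).disjSum (({k} ×ˢ slots (n + 1)).filter fun q => m < (q.2 : ℕ))

lemma inl_mem_pastNoise {t : ℕ} {m : Fin K → ℕ} {s : ℕ+} :
    .inl s ∈ pastNoise t m ↔ (s : ℕ) < t := by
  simp [pastNoise, mem_slots]

lemma inr_mem_pastNoise {t : ℕ} {m : Fin K → ℕ} {k : Fin K} {u : ℕ+} :
    .inr (k, u) ∈ pastNoise t m ↔ (u : ℕ) ≤ t ∧ (u : ℕ) ≤ m k := by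
  simp [pastNoise, mem_slots]

lemma inl_notMem_armNoise {k : Fin K} {m n : ℕ} {s : ℕ+} : .inl s ∉ armNoise k m n := by
  simp [armNoise]

lemma inr_mem_armNoise {k l : Fin K} {m n : ℕ} {u : ℕ+} :
    .inr (l, u) ∈ armNoise k m n ↔ l = k ∧ m < (u : ℕ) ∧ (u : ℕ) ≤ n := by
  simp [armNoise, mem_slots]
  tauto

lemma disjoint_armNoise_of_ne {k l : Fin K} (h : k ≠ l) (m n m' n' : ℕ) :
    Disjoint (armNoise k m n) (armNoise l m' n') := by
  refine Finset.disjoint_left.2 ?_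
  rintro (s | ⟨i, u⟩) h1 h2
  · exact inl_notMem_armNoise h1
  · exact h ((inr_mem_armNoise.1 h1).1.symm.trans (inr_mem_armNoise.1 h2).1)

lemma disjoint_armNoise_of_le {k : Fin K} {m n m' n' : ℕ} (h : n ≤ m') :
    Disjoint (armNoise k m n) (armNoise k m' n') := by
  refine Finset.disjoint_left.2 ?_
  rintro (s | ⟨i, u⟩) h1 h2
  · exact inl_notMem_armNoise h1
  · have := (inr_mem_armNoise.1 h1).2.2
    have := (inr_mem_armNoise.1 h2).2.1
    omega

lemma disjoint_singleton_armNoise (t : ℕ+) (k : Fin K) (m n : ℕ) :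
    Disjoint {.inl t} (armNoise k m n) :=
  Finset.disjoint_singleton_left.2 inl_notMem_armNoise

end Blocks

/-! ### Moments of truncated geometric waiting times -/

section Moments

variable {K : ℕ} {𝒮 Ω : Type*} {X : Fin K → 𝒮 → Bool} {S : ℕ → Ω → 𝒮} {B : Fin K → ℕ → Ω → Bool}

lemma determinedBy_waitTime (X : Fin K → 𝒮 → Bool) (S : ℕ → Ω → 𝒮) (B : Fin K → ℕ → Ω → Bool)
    (k : Fin K) (m n : ℕ) :
    DeterminedBy (noise X S B) (armNoise k m (m + n))
      (fun ω => waitTime (fun u => B k u ω) m n) := by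
  intro ω ω' h
  refine waitTime_congr fun u hu1 hu2 => ?_
  have hle := waitTime_le (fun u => B k u ω) m n
  exact congrFun (h (.inr (k, ⟨u, by omega⟩)) (inr_mem_armNoise.2 ⟨rfl, hu1, by
    simp only [PNat.mk_coe]; omega⟩)) k

lemma determinedBy_request (X : Fin K → 𝒮 → Bool) (S : ℕ → Ω → 𝒮) (B : Fin K → ℕ → Ω → Bool)
    (k : Fin K) (m : ℕ) :
    DeterminedBy (noise X S B) (armNoise k m (m + 1)) (fun ω => B k (m + 1) ω) :=
  fun _ _ h => congrFun (h (.inr (k, ⟨m + 1, by omega⟩))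
    (inr_mem_armNoise.2 ⟨rfl, by simp, by simp⟩)) k

lemma integral_toNat_eq_measureReal [MeasurableSpace Ω] (P : Measure Ω) {b : Ω → Bool}
    (hb : Measurable b) : ∫ ω, ((b ω).toNat : ℝ) ∂P = P.real {ω | b ω = true} := by
  have hs : MeasurableSet {ω | b ω = true} := hb (MeasurableSet.singleton true)
  rw [← integral_indicator_one hs]
  refine integral_congr_ae (Filter.Eventually.of_forall fun ω => ?_)
  by_cases h : b ω = true <;> simp [Set.indicator, h]

variable [MeasurableSpace Ω] {P : Measure Ω} [IsProbabilityMeasure P]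
  {p : Fin K → ℝ}

/-- First-step analysis: condition on whether the slot m + 1 has a request, which is independent of
the waiting time that starts afterwards. -/
lemma integral_comp_waitTime_succ (hB : IsRequestProcess P p B)
    (hWm : ∀ j, Measurable (noise X S B j)) (hW : iIndepFun (noise X S B) P) (φ : ℕ → ℝ)
    (k : Fin K) (m n : ℕ) :
    ∫ ω, φ (waitTime (fun u => B k u ω) m (n + 1)) ∂P =
      p k * φ 1 + (1 - p k) * ∫ ω, φ (1 + waitTime (fun u => B k u ω) (m + 1) n) ∂P := by
  have hb := determinedBy_request X S B k m
  have hT := (determinedBy_waitTime X S B k (m + 1) n).comp fun T => φ (1 + T)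
  have hm := hB.measurable k (m + 1) (by omega)
  have hp : ∫ ω, ((B k (m + 1) ω).toNat : ℝ) ∂P = p k :=
    (integral_toNat_eq_measureReal P hm).trans (hB.prob k (m + 1) (by omega))
  have hbi : Integrable (fun ω => ((B k (m + 1) ω).toNat : ℝ)) P :=
    (hb.comp fun b => (b.toNat : ℝ)).integrable hWm
  have h1 : ∫ ω, (1 - ((B k (m + 1) ω).toNat : ℝ)) ∂P = 1 - p k := by
    rw [integral_sub (integrable_const _) hbi, hp]
    simp
  have h2 := (hb.comp fun b => 1 - (b.toNat : ℝ)).integral_mul hT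
    (disjoint_armNoise_of_le le_rfl) hWm hW
  have h3 : Integrable (fun ω => (1 - ((B k (m + 1) ω).toNat : ℝ)) *
      φ (1 + waitTime (fun u => B k u ω) (m + 1) n)) P :=
    DeterminedBy.integrable (J := armNoise k m (m + 1 + n)) (W := noise X S B)
      (DeterminedBy.comp₂ (hb.mono ?_) ((determinedBy_waitTime X S B k (m + 1) n).mono ?_)
        fun b T => (1 - (b.toNat : ℝ)) * φ (1 + T)) hWm
  · rw [← h1, ← h2, ← hp, ← integral_mul_const, ← integral_add (hbi.mul_const _) h3]
    refine integral_congr_ae (Filter.Eventually.of_forall fun ω => ?_)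
    cases h : B k (m + 1) ω <;> simp [waitTime, h]
  · rintro (s | ⟨i, u⟩) h
    · exact absurd h inl_notMem_armNoise
    · have := inr_mem_armNoise.1 h
      exact inr_mem_armNoise.2 ⟨this.1, by omega, by omega⟩
  · rintro (s | ⟨i, u⟩) h
    · exact absurd h inl_notMem_armNoise
    · have := inr_mem_armNoise.1 h
      exact inr_mem_armNoise.2 ⟨this.1, by omega, by omega⟩

/-- The right side is the value for an untruncated geometric time T. Truncation only replaces (n -
T)² by 0 when T > n. The right side solves the first-step recursion exactly, so all the loss is at n
= 0. -/
lemma integral_sub_waitTime_sq_le (hB : IsRequestProcess P p B)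
    (hWm : ∀ j, Measurable (noise X S B j)) (hW : iIndepFun (noise X S B) P) (k : Fin K)
    (hp : p k ∈ Set.Ioc (0 : ℝ) 1) (m n : ℕ) :
    ∫ ω, ((n : ℝ) - waitTime (fun u => B k u ω) m n) ^ 2 ∂P ≤
      (n : ℝ) ^ 2 - 2 * n / p k + (2 - p k) / p k ^ 2 := by
  obtain ⟨h0, h1⟩ := hp
  induction n generalizing m with
  | zero =>
    simp only [waitTime, CharP.cast_eq_zero, sub_self]
    simp
    have : 0 ≤ 2 - p k := by linarith
    positivity
  | succ n ih =>
    rw [integral_comp_waitTime_succ (X := X) (S := S) hB hWm hW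
      (fun T => (((n + 1 : ℕ) : ℝ) - T) ^ 2)]
    have e : ∀ ω, (((n + 1 : ℕ) : ℝ) -
        ((1 + waitTime (fun u => B k u ω) (m + 1) n : ℕ) : ℝ)) ^ 2 =
        ((n : ℝ) - waitTime (fun u => B k u ω) (m + 1) n) ^ 2 := by
      intro ω; push_cast; ring
    simp only [e]
    have := mul_le_mul_of_nonneg_left (ih (m + 1)) (sub_nonneg.2 h1)
    refine (add_le_add_right this _).trans (le_of_eq ?_)
    push_cast
    field_simp
    ring

/-- The moment generating function of the geometric law with success probability `p`. -/
def geometricMGF (p u : ℝ) : ℝ := p * Real.exp u / (1 - (1 - p) * Real.exp u)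

/-- The geometric generating function G solves G = p e^u + (1 - p) e^u G, and it is at least 1, the
value for n = 0. -/
lemma integral_exp_waitTime_le (hB : IsRequestProcess P p B)
    (hWm : ∀ j, Measurable (noise X S B j)) (hW : iIndepFun (noise X S B) P) (k : Fin K)
    (hp : p k ∈ Set.Ioc (0 : ℝ) 1) {u : ℝ} (hu : 0 ≤ u) (hpu : (1 - p k) * Real.exp u < 1)
    (m n : ℕ) :
    ∫ ω, Real.exp (u * waitTime (fun u => B k u ω) m n) ∂P ≤ geometricMGF (p k) u := by
  have hd : 0 < 1 - (1 - p k) * Real.exp u := by linarith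
  have he := Real.one_le_exp hu
  induction n generalizing m with
  | zero =>
    simp only [waitTime, CharP.cast_eq_zero, mul_zero, Real.exp_zero]
    simp
    rw [geometricMGF, le_div_iff₀ hd]
    linarith
  | succ n ih =>
    rw [integral_comp_waitTime_succ (X := X) (S := S) hB hWm hW (fun T => Real.exp (u * T))]
    have e : ∀ ω, Real.exp (u * ((1 + waitTime (fun u => B k u ω) (m + 1) n : ℕ) : ℝ)) =
        Real.exp u * Real.exp (u * waitTime (fun u => B k u ω) (m + 1) n) := by
      intro ω
      rw [← Real.exp_add]
      push_cast
      ring_nf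
    simp only [e]
    rw [integral_const_mul]
    have := mul_le_mul_of_nonneg_left (ih (m + 1))
      (mul_nonneg (sub_nonneg.2 hp.2) (Real.exp_pos u).le)
    rw [← mul_assoc]
    refine (add_le_add_right this _).trans (le_of_eq ?_)
    rw [geometricMGF]
    field_simp
    push_cast
    ring_nf

end Moments

/-! ### The function `f` -/

lemma sq_le_exp {y : ℝ} (hy : 0 ≤ y) : y ^ 2 ≤ Real.exp y := by
  have h := Real.sum_le_exp_of_nonneg hy 4
  simp only [Finset.sum_range_succ, Finset.sum_range_zero, Nat.factorial] at h
  norm_num at h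
  nlinarith [mul_nonneg hy (sq_nonneg (y - 3 / 2))]

section MGF

variable {p p' u : ℝ}

lemma exp_le_geometricMGF (hp : p ≤ 1) (hu : 0 ≤ u) (h : (1 - p) * Real.exp u < 1) :
    Real.exp u ≤ geometricMGF p u := by
  have he := Real.one_le_exp hu
  rw [geometricMGF, le_div_iff₀ (by linarith)]
  nlinarith [mul_nonneg (mul_nonneg (sub_nonneg.2 hp) (Real.exp_pos u).le) (sub_nonneg.2 he)]

lemma one_le_geometricMGF (hp : p ≤ 1) (hu : 0 ≤ u) (h : (1 - p) * Real.exp u < 1) :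
    1 ≤ geometricMGF p u :=
  (Real.one_le_exp hu).trans (exp_le_geometricMGF hp hu h)

/-- Allows g to be evaluated at χ although requests arrive at the larger rate χ + ε. -/
lemma geometricMGF_anti (hp : p ≤ p') (hu : 0 ≤ u) (h : (1 - p) * Real.exp u < 1) :
    geometricMGF p' u ≤ geometricMGF p u := by
  have he := Real.one_le_exp hu
  have h' : (1 - p') * Real.exp u ≤ (1 - p) * Real.exp u :=
    mul_le_mul_of_nonneg_right (by linarith) (Real.exp_pos u).le
  rw [geometricMGF, geometricMGF, div_le_div_iff₀ (by linarith) (by linarith)]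
  nlinarith [mul_nonneg (Real.exp_pos u).le
    (mul_nonneg (sub_nonneg.2 hp) (sub_nonneg.2 he))]

end MGF

section Bound

variable {K : ℕ} {x y : Fin K → ℝ} {θ : ℝ}

lemma gProd_eq_prod_geometricMGF (x y : Fin K → ℝ) (θ : ℝ) :
    gProd x y θ = ∏ k, geometricMGF (y k) (2 * θ / x k) := rfl

lemma geometricMGF_le_gProd (hx : ∀ k, 0 < x k) (hy : ∀ k, y k ≤ 1) (hθ : 0 ≤ θ)
    (h : ∀ k, (1 - y k) * Real.exp (2 * θ / x k) < 1) (k : Fin K) :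
    geometricMGF (y k) (2 * θ / x k) ≤ gProd x y θ := by
  rw [gProd_eq_prod_geometricMGF]
  have h1 : ∀ l, 1 ≤ geometricMGF (y l) (2 * θ / x l) := fun l =>
    one_le_geometricMGF (hy l) (div_nonneg (by positivity) (hx l).le) (h l)
  rw [← Finset.mul_prod_erase _ _ (Finset.mem_univ k)]
  refine le_mul_of_one_le_right (zero_le_one.trans (h1 k)) ?_
  exact Finset.prod_induction _ (1 ≤ ·) (fun _ _ => one_le_mul_of_one_le_of_one_le) le_rfl
    fun l _ => h1 l

variable [NeZero K]

lemma exp_le_gProd (hx : ∀ k, x k ∈ Set.Ioc (0 : ℝ) 1) (hy : ∀ k, y k ≤ 1)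
    (hθ : θ ∈ thetaRange x y) : Real.exp (2 * θ) ≤ gProd x y θ := by
  obtain ⟨h0, -, h⟩ := hθ
  have hu : 2 * θ ≤ 2 * θ / x 0 := le_div_self (by linarith) (hx 0).1 (hx 0).2
  exact (Real.exp_le_exp.2 hu).trans <| (exp_le_geometricMGF (hy 0) (by linarith) (h 0)).trans
    (geometricMGF_le_gProd (fun k => (hx k).1) hy h0.le h 0)

lemma one_le_gProd (hx : ∀ k, x k ∈ Set.Ioc (0 : ℝ) 1) (hy : ∀ k, y k ≤ 1)
    (hθ : θ ∈ thetaRange x y) : 1 ≤ gProd x y θ :=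
  (Real.one_le_exp (by linarith [hθ.1])).trans (exp_le_gProd hx hy hθ)

/-- Equivalent to θ⁴ ≤ g, which follows from θ² ≤ e^θ and g ≥ e^{2θ}. It lets a logarithm of g be
absorbed into one of g / θ². -/
lemma gProd_le_sq (hx : ∀ k, x k ∈ Set.Ioc (0 : ℝ) 1) (hy : ∀ k, y k ≤ 1)
    (hθ : θ ∈ thetaRange x y) : gProd x y θ ≤ (gProd x y θ / θ ^ 2) ^ 2 := by
  have h0 := hθ.1
  have h1 := exp_le_gProd hx hy hθ
  have h2 := sq_le_exp h0.le
  have h3 : (θ ^ 2) ^ 2 ≤ gProd x y θ := by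
    refine le_trans ?_ h1
    rw [two_mul, Real.exp_add, ← sq]
    exact pow_le_pow_left₀ (by positivity) h2 2
  rw [div_pow, le_div_iff₀ (by positivity), sq (gProd x y θ)]
  exact mul_le_mul_of_nonneg_left h3 (zero_le_one.trans (one_le_gProd hx hy hθ))

lemma one_le_gProd_div_sq (hx : ∀ k, x k ∈ Set.Ioc (0 : ℝ) 1) (hy : ∀ k, y k ≤ 1)
    (hθ : θ ∈ thetaRange x y) : 1 ≤ gProd x y θ / θ ^ 2 := by
  have h0 := hθ.1
  have h1 := one_le_gProd hx hy hθ
  have := h1.trans (gProd_le_sq hx hy hθ)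
  exact (one_le_sq_iff₀ (by positivity)).1 this

lemma one_le_log {a : ℝ} (ha : 3 ≤ a) : 1 ≤ Real.log a := by
  rw [Real.le_log_iff_exp_le (by linarith)]
  linarith [Real.exp_one_lt_d9]

lemma one_le_log_gProd (hx : ∀ k, x k ∈ Set.Ioc (0 : ℝ) 1) (hy : ∀ k, y k ≤ 1)
    (hθ : θ ∈ thetaRange x y) : 1 ≤ Real.log (32 * gProd x y θ / θ ^ 2) := by
  refine one_le_log ?_
  rw [mul_div_assoc]
  linarith [one_le_gProd_div_sq hx hy hθ]

/-- Any θ strictly below h keeps every denominator positive; the witness is h / 2. -/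
lemma thetaRange_nonempty (hx : ∀ k, 0 < x k) (hy : ∀ k, y k ∈ Set.Ioo (0 : ℝ) 1) :
    (thetaRange x y).Nonempty := by
  set xm := Finset.univ.inf' Finset.univ_nonempty x with hxm
  set ym := Finset.univ.inf' Finset.univ_nonempty y with hym
  have hx0 : 0 < xm := (Finset.lt_inf'_iff _).2 fun k _ => hx k
  have hy0 : 0 < ym := (Finset.lt_inf'_iff _).2 fun k _ => (hy k).1
  have hxk : ∀ k, xm ≤ x k := fun k => Finset.inf'_le _ (Finset.mem_univ k)
  have hyk : ∀ k, ym ≤ y k := fun k => Finset.inf'_le _ (Finset.mem_univ k)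
  have hy1 : ym < 1 := (hyk 0).trans_lt (hy 0).2
  have hlog : Real.log (1 - ym) < 0 := Real.log_neg (by linarith) (by linarith)
  have hh : hBound x y = -(xm / 2) * Real.log (1 - ym) := rfl
  have hpos : 0 < hBound x y := by rw [hh]; nlinarith
  refine ⟨hBound x y / 2, by positivity, by linarith, fun k => ?_⟩
  have hu : 2 * (hBound x y / 2) / x k < -Real.log (1 - ym) := by
    rw [div_lt_iff₀ (hx k), hh]
    nlinarith [hxk k, hx k]
  have he := Real.exp_lt_exp.2 hu
  rw [Real.exp_neg, Real.exp_log (by linarith), lt_inv_comm₀ (Real.exp_pos _) (by linarith)] at he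
  calc _ ≤ (1 - ym) * Real.exp (2 * (hBound x y / 2) / x k) :=
        mul_le_mul_of_nonneg_right (by linarith [hyk k]) (Real.exp_pos _).le
    _ < (Real.exp (2 * (hBound x y / 2) / x k))⁻¹ * Real.exp (2 * (hBound x y / 2) / x k) :=
        mul_lt_mul_of_pos_right he (Real.exp_pos _)
    _ = 1 := inv_mul_cancel₀ (Real.exp_pos _).ne'

lemma gProd_div_sq_le_fObjective (hx : ∀ k, x k ∈ Set.Ioc (0 : ℝ) 1) (hy : ∀ k, y k ≤ 1)
    (hθ : θ ∈ thetaRange x y) : gProd x y θ / θ ^ 2 ≤ fObjective x y θ := by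
  have h1 := one_le_gProd_div_sq hx hy hθ
  have h2 := one_le_log_gProd hx hy hθ
  rw [fObjective, mul_div_assoc]
  nlinarith

/-- The minimum defining `f(y)` is attained. -/
lemma isLeast_fBound (hx : ∀ k, x k ∈ Set.Ioc (0 : ℝ) 1) (hy : ∀ k, y k ∈ Set.Ioo (0 : ℝ) 1) :
    IsLeast (fObjective x y '' thetaRange x y) (fBound x y) := by
  obtain ⟨θ₀, hθ₀⟩ := thetaRange_nonempty (fun k => (hx k).1) hy
  have hy1 : ∀ k, y k ≤ 1 := fun k => (hy k).2.le
  set c := fObjective x y θ₀ with hc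
  have hc1 : 1 ≤ c := (one_le_gProd_div_sq hx hy1 hθ₀).trans (gProd_div_sq_le_fObjective hx hy1 hθ₀)
  set h := hBound x y with hh
  have hpos : 0 < h := hθ₀.1.trans_le hθ₀.2.1
  set C := c * h ^ 2 with hC
  have hCpos : 0 < C := by positivity
  -- A compact set that contains the sublevel set of the value c at θ₀. Since the objective
  -- dominates g / θ², a value at most c forces θ ≥ 1/c (from g ≥ 1 and c ≥ 1) and g ≤ c h² = C, and
  -- the latter keeps each denominator at least y_k / C.
  let T : Set ℝ := Set.Icc (1 / c) h ∩
    ⋂ k, {θ | (1 - y k) * Real.exp (2 * θ / x k) ≤ 1 - y k / C}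
  have hTc : IsCompact T := by
    refine isCompact_Icc.inter_right (isClosed_iInter fun k => isClosed_le ?_ continuous_const)
    fun_prop
  have hTsub : T ⊆ thetaRange x y := by
    rintro θ ⟨⟨h1, h2⟩, h3⟩
    refine ⟨lt_of_lt_of_le (by positivity) h1, h2, fun k => ?_⟩
    have := Set.mem_iInter.1 h3 k
    have hk : 0 < y k / C := div_pos (hy k).1 hCpos
    exact lt_of_le_of_lt this (by linarith)
  have hmem : ∀ θ ∈ thetaRange x y, fObjective x y θ ≤ c → θ ∈ T := by
    intro θ hθ hle
    have hq := (gProd_div_sq_le_fObjective hx hy1 hθ).trans hle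
    have h0 := hθ.1
    have hg1 := one_le_gProd hx hy1 hθ
    rw [div_le_iff₀ (by positivity)] at hq
    have hgC : gProd x y θ ≤ C :=
      hq.trans (mul_le_mul_of_nonneg_left (pow_le_pow_left₀ h0.le hθ.2.1 2) (by linarith))
    refine ⟨⟨?_, hθ.2.1⟩, Set.mem_iInter.2 fun k => ?_⟩
    · rw [div_le_iff₀ (by linarith)]
      have : 1 ≤ c ^ 2 * θ ^ 2 := by nlinarith [sq_nonneg θ]
      rw [← mul_pow, one_le_sq_iff₀ (by positivity)] at this
      linarith
    · have hk := (geometricMGF_le_gProd (fun k => (hx k).1) hy1 h0.le hθ.2.2 k).trans hgC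
      have hd := hθ.2.2 k
      rw [geometricMGF, div_le_iff₀ (by linarith)] at hk
      have he : 1 ≤ Real.exp (2 * θ / x k) :=
        Real.one_le_exp (div_nonneg (by linarith) (hx k).1.le)
      have : y k / C ≤ 1 - (1 - y k) * Real.exp (2 * θ / x k) := by
        rw [div_le_iff₀ hCpos]
        nlinarith [(hy k).1]
      change (1 - y k) * Real.exp (2 * θ / x k) ≤ 1 - y k / C
      linarith
  have hcont : ContinuousOn (fObjective x y) T := by
    have hg : ContinuousOn (gProd x y) T := by
      refine continuousOn_finsetProd _ fun k _ => ?_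
      refine ContinuousOn.div (by fun_prop) (by fun_prop) fun θ hθ => ?_
      have := (hTsub hθ).2.2 k
      linarith
    have hsq : ∀ θ ∈ T, θ ^ 2 ≠ 0 := fun θ hθ => pow_ne_zero 2 (hTsub hθ).1.ne'
    refine ContinuousOn.mul ((continuousOn_const.mul hg).div (by fun_prop) hsq) ?_
    refine ContinuousOn.log ((continuousOn_const.mul hg).div (by fun_prop) hsq) fun θ hθ => ?_
    have := one_le_gProd hx hy1 (hTsub hθ)
    exact div_ne_zero (by positivity) (hsq θ hθ)
  obtain ⟨θ, hθT, hmin⟩ := hTc.exists_isMinOn ⟨θ₀, hmem θ₀ hθ₀ le_rfl⟩ hcont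
  have hleast : IsLeast (fObjective x y '' thetaRange x y) (fObjective x y θ) := by
    refine ⟨⟨θ, hTsub hθT, rfl⟩, ?_⟩
    rintro _ ⟨θ', hθ', rfl⟩
    by_cases hle : fObjective x y θ' ≤ c
    · exact hmin (hmem θ' hθ' hle)
    · exact (hmin (hmem θ₀ hθ₀ le_rfl)).trans (not_le.1 hle).le
  rw [fBound, hleast.csInf_eq]
  exact hleast

end Bound

/-! ### Weighted Euclidean norms -/

section Norm

variable {K : ℕ} {w v v' : Fin K → ℝ}

/-- The Euclidean norm of `v` with the weights `√(w k)`. -/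
def weightedNorm (w v : Fin K → ℝ) : ℝ :=
  ‖(WithLp.toLp 2 (fun k => Real.sqrt (w k) * v k) : EuclideanSpace ℝ (Fin K))‖

lemma weightedNorm_nonneg (w v : Fin K → ℝ) : 0 ≤ weightedNorm w v := norm_nonneg _

lemma weightedNorm_sq (hw : ∀ k, 0 ≤ w k) (v : Fin K → ℝ) :
    weightedNorm w v ^ 2 = ∑ k, w k * v k ^ 2 := by
  rw [weightedNorm, EuclideanSpace.norm_sq_eq]
  refine Finset.sum_congr rfl fun k _ => ?_
  rw [Real.norm_eq_abs, sq_abs, mul_pow, Real.sq_sqrt (hw k)]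

lemma weightedNorm_mono (hw : ∀ k, 0 ≤ w k) (hv : ∀ k, 0 ≤ v k) (h : ∀ k, v k ≤ v' k) :
    weightedNorm w v ≤ weightedNorm w v' := by
  rw [← pow_le_pow_iff_left₀ (weightedNorm_nonneg _ _) (weightedNorm_nonneg _ _) two_ne_zero,
    weightedNorm_sq hw, weightedNorm_sq hw]
  exact Finset.sum_le_sum fun k _ =>
    mul_le_mul_of_nonneg_left (pow_le_pow_left₀ (hv k) (h k) 2) (hw k)

lemma weightedNorm_le_sum (w v : Fin K → ℝ) :
    weightedNorm w v ≤ ∑ k, Real.sqrt (w k) * |v k| := by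
  have h0 : ∀ k, 0 ≤ Real.sqrt (w k) * |v k| := fun k => by positivity
  rw [weightedNorm, EuclideanSpace.norm_eq]
  refine Real.sqrt_le_iff.2 ⟨Finset.sum_nonneg fun k _ => h0 k, ?_⟩
  rw [sq (∑ k, _), Finset.sum_mul]
  refine Finset.sum_le_sum fun k hk => ?_
  rw [Real.norm_eq_abs, abs_mul, abs_of_nonneg (Real.sqrt_nonneg _), sq]
  exact mul_le_mul_of_nonneg_left (Finset.single_le_sum (fun l _ => h0 l) hk) (h0 k)

lemma abs_weightedNorm_sub_le (w v v' : Fin K → ℝ) :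
    |weightedNorm w v - weightedNorm w v'| ≤ ∑ k, Real.sqrt (w k) * |v k - v' k| := by
  refine le_trans ?_ (weightedNorm_le_sum w fun k => v k - v' k)
  refine (abs_norm_sub_norm_le _ _).trans (le_of_eq ?_)
  rw [weightedNorm, ← WithLp.toLp_sub]
  congr 2
  ext k
  simp [mul_sub]

end Norm

/-! ### Exponential moments of increments with negative drift -/

/-- The Taylor remainder is at most (sv)² e^{s|v|}. Since s ≤ 1/2, one factor e^{|v|/2} pays for
e^{s|v|} and another, with constant 4, for v². -/
lemma exp_mul_le {s v : ℝ} (h0 : 0 ≤ s) (h1 : s ≤ 1 / 2) :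
    Real.exp (s * v) ≤ 1 + s * v + 4 * s ^ 2 * Real.exp |v| := by
  have h := Complex.norm_exp_sub_sum_le_norm_mul_exp ((s * v : ℝ) : ℂ) 2
  simp only [Finset.sum_range_succ, Finset.sum_range_zero, Nat.factorial] at h
  have e : Complex.exp ((s * v : ℝ) : ℂ) - (0 + ((s * v : ℝ) : ℂ) ^ 0 / ((1 : ℕ) : ℂ) +
      ((s * v : ℝ) : ℂ) ^ 1 / (((0 + 1) * 1 : ℕ) : ℂ)) =
      ((Real.exp (s * v) - 1 - s * v : ℝ) : ℂ) := by
    push_cast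
    ring
  rw [e, Complex.norm_real, Complex.norm_real, Real.norm_eq_abs, Real.norm_eq_abs, sq_abs,
    abs_mul, abs_of_nonneg h0] at h
  have h2 := (le_abs_self _).trans h
  have h3 := sq_le_exp (y := |v| / 2) (by positivity)
  have h4 : Real.exp (s * |v|) ≤ Real.exp (|v| / 2) :=
    Real.exp_le_exp.2 (by nlinarith [abs_nonneg v])
  have h5 : Real.exp |v| = Real.exp (|v| / 2) * Real.exp (|v| / 2) := by
    rw [← Real.exp_add]; ring_nf
  have h6 : |v| ^ 2 * Real.exp (s * |v|) ≤ 4 * Real.exp |v| := by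
    rw [h5]
    have : |v| ^ 2 ≤ 4 * Real.exp (|v| / 2) := by nlinarith
    calc _ ≤ (4 * Real.exp (|v| / 2)) * Real.exp (|v| / 2) := by gcongr
      _ = _ := by ring
  have h7 := mul_le_mul_of_nonneg_left h6 (sq_nonneg s)
  rw [mul_pow] at h2
  rw [sq_abs] at h7
  linarith

/-- A bound on the exponential moment of an increment with negative drift. -/
lemma integral_exp_mul_le {Ω : Type*} [MeasurableSpace Ω] {P : Measure Ω} [IsProbabilityMeasure P]
    {D : Ω → ℝ} {s θ g δ : ℝ} (h0 : 0 ≤ s) (h1 : s ≤ 1 / 2) (hθ : 0 < θ) (hD : Integrable D P)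
    (hs : Integrable (fun ω => Real.exp (s * (θ * D ω))) P)
    (he : Integrable (fun ω => Real.exp (θ * |D ω|)) P)
    (hg : ∫ ω, Real.exp (θ * |D ω|) ∂P ≤ g) (hδ : ∫ ω, D ω ∂P ≤ -δ) :
    ∫ ω, Real.exp (s * (θ * D ω)) ∂P ≤ 1 - s * θ * δ + 4 * s ^ 2 * g := by
  have hle : ∀ ω, Real.exp (s * (θ * D ω)) ≤
      1 + s * θ * D ω + 4 * s ^ 2 * Real.exp (θ * |D ω|) := fun ω => by
    have := exp_mul_le (v := θ * D ω) h0 h1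
    rw [abs_mul, abs_of_pos hθ] at this
    rwa [mul_assoc s θ]
  have i1 : Integrable (fun ω => 1 + s * θ * D ω) P :=
    (integrable_const 1).add (hD.const_mul (s * θ))
  have i2 : Integrable (fun ω => 4 * s ^ 2 * Real.exp (θ * |D ω|)) P := he.const_mul _
  have hint := integral_mono hs (i1.add i2) hle
  simp only [Pi.add_apply] at hint
  rw [integral_add i1 i2, integral_add (integrable_const 1) (hD.const_mul (s * θ)),
    integral_const_mul, integral_const_mul] at hint
  simp only [integral_const, probReal_univ, one_smul] at hint
  have k1 := mul_le_mul_of_nonneg_left hδ (mul_nonneg h0 hθ.le)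
  have k2 := mul_le_mul_of_nonneg_left hg (by positivity : 0 ≤ 4 * s ^ 2)
  linarith

/-! ### One transition of the ages, driven by fresh noise -/

section OneStep

variable {K : ℕ} {𝒮 Ω : Type*} {X : Fin K → 𝒮 → Bool} {S : ℕ → Ω → 𝒮} {B : Fin K → ℕ → Ω → Bool}

/-- The waiting time for the next request of arm `k` after the head-of-line request, if the age of
the latter is `z k` in slot `t`. -/
def nextWait (B : Fin K → ℕ → Ω → Bool) (t : ℕ) (z : Fin K → ℕ) (k : Fin K) (ω : Ω) : ℕ :=
  waitTime (fun u => B k u ω) (t - z k) (z k + 1)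

/-- An upper bound for the age of arm `k` in slot `t + 1` if the ages in slot `t` are `z` and the
arms `k` with `i k` are scheduled. It only depends on fresh noise. -/
def nextAge (X : Fin K → 𝒮 → Bool) (S : ℕ → Ω → 𝒮) (B : Fin K → ℕ → Ω → Bool) (t : ℕ)
    (z : Fin K → ℕ) (i : Fin K → Bool) (k : Fin K) (ω : Ω) : ℝ :=
  (z k : ℝ) + 1 - ((X k (S t ω) && i k).toNat : ℝ) * nextWait B t z k ω

/-- The noise that determines the transition from slot `t` to slot `t + 1`. -/
def freshNoise (t : ℕ+) (z : Fin K → ℕ) : Finset (ℕ+ ⊕ (Fin K × ℕ+)) := by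
  classical
  exact {.inl t} ∪ Finset.univ.biUnion fun k => armNoise k (t - z k) (t + 1)

lemma disjoint_pastNoise_freshNoise (t : ℕ+) (z : Fin K → ℕ) :
    Disjoint (pastNoise (t : ℕ) fun k => t - z k) (freshNoise t z) := by
  classical
  rw [freshNoise, Finset.disjoint_union_right, Finset.disjoint_singleton_right,
    Finset.disjoint_biUnion_right]
  refine ⟨fun h => lt_irrefl _ (inl_mem_pastNoise.1 h), fun k _ => ?_⟩
  refine Finset.disjoint_left.2 ?_
  rintro (s | ⟨l, u⟩) h1 h2
  · exact inl_notMem_armNoise h2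
  · obtain ⟨rfl, h3, -⟩ := inr_mem_armNoise.1 h2
    have := (inr_mem_pastNoise.1 h1).2
    omega

lemma determinedBy_state (X : Fin K → 𝒮 → Bool) (S : ℕ → Ω → 𝒮) (B : Fin K → ℕ → Ω → Bool)
    (t : ℕ+) (k : Fin K) :
    DeterminedBy (noise X S B) {.inl t} (fun ω => X k (S t ω)) :=
  fun _ _ h => congrFun (h (.inl t) (Finset.mem_singleton_self _)) k

variable {t : ℕ+} {z : Fin K → ℕ} {i : Fin K → Bool}

lemma determinedBy_nextWait (X : Fin K → 𝒮 → Bool) (S : ℕ → Ω → 𝒮) (B : Fin K → ℕ → Ω → Bool)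
    (hz : ∀ k, z k < t) (k : Fin K) :
    DeterminedBy (noise X S B) (armNoise k (t - z k) (t + 1)) (nextWait B t z k) := by
  have h := determinedBy_waitTime X S B k (t - z k) (z k + 1)
  rwa [show (t : ℕ) - z k + (z k + 1) = t + 1 by have := hz k; omega] at h

lemma determinedBy_nextAge (X : Fin K → 𝒮 → Bool) (S : ℕ → Ω → 𝒮) (B : Fin K → ℕ → Ω → Bool)
    (hz : ∀ k, z k < t) (i : Fin K → Bool) (k : Fin K) :
    DeterminedBy (noise X S B) (freshNoise t z) (nextAge X S B t z i k) := by
  classical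
  refine DeterminedBy.comp₂ ((determinedBy_state X S B t k).mono ?_)
    ((determinedBy_nextWait X S B hz k).mono ?_)
    fun b T => (z k : ℝ) + 1 - ((b && i k).toNat : ℝ) * (T : ℝ)
  · exact Finset.subset_union_left
  · exact (Finset.subset_biUnion_of_mem (fun k => armNoise k (t - z k) (t + 1))
      (Finset.mem_univ k)).trans Finset.subset_union_right

lemma one_le_nextWait (B : Fin K → ℕ → Ω → Bool) (t : ℕ) (z : Fin K → ℕ) (k : Fin K) (ω : Ω) :
    (1 : ℝ) ≤ nextWait B t z k ω :=
  mod_cast one_le_waitTime _ _ _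

lemma abs_nextAge_sub_le (X : Fin K → 𝒮 → Bool) (S : ℕ → Ω → 𝒮) (B : Fin K → ℕ → Ω → Bool) (t : ℕ)
    (z : Fin K → ℕ) (i : Fin K → Bool) (k : Fin K) (ω : Ω) :
    |nextAge X S B t z i k ω - z k| ≤ nextWait B t z k ω := by
  have h1 := one_le_nextWait B t z k ω
  rw [nextAge, abs_le]
  cases X k (S t ω) && i k <;> simp only [Bool.toNat_false, Bool.toNat_true, Nat.cast_zero,
    Nat.cast_one] <;> constructor <;> linarith

variable [MeasurableSpace Ω] {P : Measure Ω} [IsProbabilityMeasure P] {p x : Fin K → ℝ}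

/-- For a scheduled arm, the weight p/x cancels the success probability x, and the mean waiting time
1/p cancels p; a delivery therefore contributes the clean drift -2z. The remaining constants are
covered by 2/(px). -/
lemma integral_nextAge_sq_le (hB : IsRequestProcess P p B)
    (hWm : ∀ j, Measurable (noise X S B j)) (hW : iIndepFun (noise X S B) P)
    (hp : ∀ k, p k ∈ Set.Ioc (0 : ℝ) 1) (hx : ∀ k, x k ∈ Set.Ioc (0 : ℝ) 1)
    (hXx : ∀ k, ∫ ω, ((X k (S t ω)).toNat : ℝ) ∂P = x k) (hz : ∀ k, z k < t) (k : Fin K) :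
    p k / x k * ∫ ω, nextAge X S B t z i k ω ^ 2 ∂P ≤
      p k / x k * (z k : ℝ) ^ 2 + 2 * (p k / x k * z k - z k * ((i k).toNat : ℝ))
        + 2 / (p k * x k) := by
  obtain ⟨hp0, hp1⟩ := hp k
  obtain ⟨hx0, hx1⟩ := hx k
  have hmono : p k / x k * ((z k : ℝ) + 1) ^ 2 ≤
      p k / x k * (z k : ℝ) ^ 2 + 2 * (p k / x k * z k) + 2 / (p k * x k) := by
    have : p k / x k ≤ 2 / (p k * x k) := by
      rw [div_le_div_iff₀ hx0 (by positivity)]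
      nlinarith [mul_nonneg hp0.le hx0.le]
    nlinarith
  cases hi : i k
  · simp only [nextAge, hi, Bool.and_false, Bool.toNat_false, Nat.cast_zero, zero_mul, sub_zero,
      integral_const, probReal_univ, one_smul, mul_zero]
    exact hmono
  · have hT := integral_sub_waitTime_sq_le hB hWm hW k (hp k) (t - z k) (z k + 1)
    have hY := determinedBy_state X S B t k
    have hTd := determinedBy_nextWait X S B hz k
    have hprod := (hY.comp fun b => (b.toNat : ℝ)).integral_mul
      (hTd.comp fun T => (((z k + 1 : ℕ) : ℝ) - T) ^ 2 - (((z k + 1 : ℕ) : ℝ)) ^ 2)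
      (disjoint_singleton_armNoise t k _ _) hWm hW
    have hTi : Integrable (fun ω => (((z k + 1 : ℕ) : ℝ) - nextWait B t z k ω) ^ 2) P :=
      (hTd.comp fun T => (((z k + 1 : ℕ) : ℝ) - T) ^ 2).integrable hWm
    have hdet : Integrable (fun ω => ((X k (S t ω)).toNat : ℝ) *
        ((((z k + 1 : ℕ) : ℝ) - nextWait B t z k ω) ^ 2 - (((z k + 1 : ℕ) : ℝ)) ^ 2)) P := by
      classical
      exact ((hY.mono Finset.subset_union_left).comp₂ (hTd.mono Finset.subset_union_right)
        fun b T => (b.toNat : ℝ) *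
          ((((z k + 1 : ℕ) : ℝ) - T) ^ 2 - (((z k + 1 : ℕ) : ℝ)) ^ 2)).integrable hWm
    rw [integral_sub hTi (integrable_const _), hXx] at hprod
    have heq : ∀ ω, nextAge X S B t z i k ω ^ 2 = ((z k : ℝ) + 1) ^ 2 +
        ((X k (S t ω)).toNat : ℝ) *
          ((((z k + 1 : ℕ) : ℝ) - nextWait B t z k ω) ^ 2 - (((z k + 1 : ℕ) : ℝ)) ^ 2) := by
      intro ω
      rw [nextAge, hi]
      cases X k (S t ω) <;> simp
    simp only [heq]
    rw [integral_add (integrable_const _) hdet, hprod]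
    simp only [integral_const, probReal_univ, one_smul, Bool.toNat_true, Nat.cast_one, mul_one]
    change ∫ ω, (((z k + 1 : ℕ) : ℝ) - nextWait B t z k ω) ^ 2 ∂P ≤ _ at hT
    set V := ∫ ω, (((z k + 1 : ℕ) : ℝ) - nextWait B t z k ω) ^ 2 ∂P
    push_cast at hT ⊢
    have e1 : p k / x k * (((z k : ℝ) + 1) ^ 2 + x k * (V - ((z k : ℝ) + 1) ^ 2)) =
        p k / x k * ((z k : ℝ) + 1) ^ 2 + p k * (V - ((z k : ℝ) + 1) ^ 2) := by
      field_simp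
    have e2 : p k * (V - ((z k : ℝ) + 1) ^ 2) ≤ -2 * ((z k : ℝ) + 1) + (2 / p k - 1) := by
      have := mul_le_mul_of_nonneg_left (sub_le_sub_right hT (((z k : ℝ) + 1) ^ 2)) hp0.le
      refine this.trans (le_of_eq ?_)
      field_simp
      ring
    have e3 : p k / x k + 2 / p k - 3 ≤ 2 / (p k * x k) := by
      rw [← sub_nonneg]
      have : 2 / (p k * x k) - (p k / x k + 2 / p k - 3) =
          (2 - p k ^ 2 - 2 * x k + 3 * p k * x k) / (p k * x k) := by
        field_simp
        ring
      rw [this]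
      refine div_nonneg ?_ (by positivity)
      nlinarith [mul_nonneg (sub_nonneg.2 hp1) (sub_nonneg.2 hx1), mul_pos hp0 hx0]
    rw [e1]
    nlinarith

/-- The norm changes by at most the sum of the waiting times divided by x_k. These are independent
over arms, so the expectation factors into geometric generating functions. -/
lemma integral_exp_nextAge_le (hB : IsRequestProcess P p B)
    (hWm : ∀ j, Measurable (noise X S B j)) (hW : iIndepFun (noise X S B) P)
    (hp : ∀ k, p k ∈ Set.Ioc (0 : ℝ) 1) (hx : ∀ k, x k ∈ Set.Ioc (0 : ℝ) 1) (hz : ∀ k, z k < t)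
    {θ : ℝ} (hθ : 0 ≤ θ) (hpθ : ∀ k, (1 - p k) * Real.exp (2 * θ / x k) < 1) :
    ∫ ω, Real.exp (2 * θ * |weightedNorm (fun k => p k / x k) (fun k => nextAge X S B t z i k ω)
      - weightedNorm (fun k => p k / x k) (fun k => (z k : ℝ))|) ∂P ≤ gProd x p θ := by
  have hTd := fun k => (determinedBy_nextWait X S B hz k).comp fun T =>
    Real.exp (2 * θ / x k * (T : ℝ))
  have hprod := DeterminedBy.integral_prod hTd
    (fun k l hkl => disjoint_armNoise_of_ne hkl _ _ _ _) hWm hW Finset.univ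
  have hbound : ∀ k, ∫ ω, Real.exp (2 * θ / x k * (nextWait B t z k ω : ℝ)) ∂P ≤
      geometricMGF (p k) (2 * θ / x k) := fun k =>
    integral_exp_waitTime_le hB hWm hW k (hp k) (div_nonneg (by linarith) (hx k).1.le) (hpθ k) _ _
  rw [gProd_eq_prod_geometricMGF]
  refine le_trans ?_ (Finset.prod_le_prod (fun k _ => integral_nonneg fun ω => (Real.exp_pos _).le)
    fun k _ => hbound k)
  rw [← hprod]
  refine integral_mono_of_nonneg (Filter.Eventually.of_forall fun ω => (Real.exp_pos _).le)
    ?_ (Filter.Eventually.of_forall fun ω => ?_)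
  · classical
    refine DeterminedBy.integrable (J := Finset.univ.biUnion
      fun k => armNoise k (t - z k) (t + 1)) (W := noise X S B) ?_ hWm
    exact (DeterminedBy.of_forall fun k => (hTd k).mono (Finset.subset_biUnion_of_mem
      (fun k => armNoise k (t - z k) (t + 1)) (Finset.mem_univ k))).comp fun v => ∏ k, v k
  · dsimp only
    rw [← Real.exp_sum, Real.exp_le_exp]
    refine (mul_le_mul_of_nonneg_left (abs_weightedNorm_sub_le _ _ _) (by positivity)).trans ?_
    rw [Finset.mul_sum]
    refine Finset.sum_le_sum fun k _ => ?_
    have h1 : Real.sqrt (p k / x k) ≤ 1 / x k := by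
      obtain ⟨hx0, hx1⟩ := hx k
      refine Real.sqrt_le_iff.2 ⟨by positivity, ?_⟩
      rw [div_pow, div_le_div_iff₀ hx0 (by positivity)]
      nlinarith [(hp k).1, (hp k).2, mul_nonneg hx0.le hx0.le]
    have h2 := abs_nextAge_sub_le X S B t z i k ω
    have h3 := mul_le_mul h1 h2 (abs_nonneg _) (by have := (hx k).1; positivity)
    calc _ ≤ 2 * θ * (1 / x k * nextWait B t z k ω) :=
          mul_le_mul_of_nonneg_left h3 (by positivity)
      _ = _ := by ring

end OneStep

/-! ### Drift of the weighted norm and of its exponential -/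

section OneStep

variable {K : ℕ} [NeZero K] {𝒮 Ω : Type*} {X : Fin K → 𝒮 → Bool} {S : ℕ → Ω → 𝒮}
  {B : Fin K → ℕ → Ω → Bool} {p x χ : Fin K → ℝ} {γ η θ : ℝ}

/-- The level of the weighted age norm above which its drift is at most `-γ/4`. -/
def driftLevel (x χ : Fin K → ℝ) (γ η : ℝ) : ℝ :=
  4 / γ * ∑ k, 1 / (χ k * x k) + 4 * (K : ℝ) * η / γ

/-- The exponent of the exponential Lyapunov function. -/
def lyapunovRate (x χ : Fin K → ℝ) (γ θ : ℝ) : ℝ := γ * θ ^ 2 / (8 * gProd x χ θ)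

lemma driftLevel_pos (hx : ∀ k, x k ∈ Set.Ioc (0 : ℝ) 1) (hχ : ∀ k, 0 < χ k) (hγ : 0 < γ)
    (hη : 0 < η) : 0 < driftLevel x χ γ η := by
  have hK : (0 : ℝ) < K := by exact_mod_cast NeZero.pos K
  have : 0 ≤ ∑ k, 1 / (χ k * x k) := Finset.sum_nonneg fun k _ => by
    have := (hx k).1
    have := hχ k
    positivity
  rw [driftLevel]
  positivity

lemma lyapunovRate_pos (hx : ∀ k, x k ∈ Set.Ioc (0 : ℝ) 1) (hχ : ∀ k, χ k ≤ 1) (hγ : 0 < γ)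
    (hθ : θ ∈ thetaRange x χ) : 0 < lyapunovRate x χ γ θ := by
  have := one_le_gProd hx hχ hθ
  have := hθ.1
  rw [lyapunovRate]
  positivity

lemma lyapunovRate_le (hx : ∀ k, x k ∈ Set.Ioc (0 : ℝ) 1) (hχ : ∀ k, χ k ≤ 1)
    (hγ : γ ∈ Set.Ioc (0 : ℝ) 1) (hθ : θ ∈ thetaRange x χ) : lyapunovRate x χ γ θ ≤ θ := by
  have h1 := exp_le_gProd hx hχ hθ
  have h2 := Real.add_one_le_exp (2 * θ)
  have h0 := hθ.1
  rw [lyapunovRate, div_le_iff₀ (by linarith)]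
  nlinarith [hγ.1, hγ.2, mul_nonneg h0.le h0.le]

lemma lyapunovRate_le_one (hx : ∀ k, x k ∈ Set.Ioc (0 : ℝ) 1) (hχ : ∀ k, χ k ≤ 1)
    (hγ : γ ∈ Set.Ioc (0 : ℝ) 1) (hθ : θ ∈ thetaRange x χ) : lyapunovRate x χ γ θ ≤ 1 := by
  have h1 := one_le_gProd_div_sq hx hχ hθ
  have h0 := hθ.1
  have h2 := one_le_gProd hx hχ hθ
  rw [le_div_iff₀ (by positivity)] at h1
  rw [lyapunovRate, div_le_one (by linarith)]
  nlinarith [hγ.1, hγ.2, sq_nonneg θ]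

variable [MeasurableSpace Ω] {P : Measure Ω} [IsProbabilityMeasure P] {t : ℕ+} {z : Fin K → ℕ}
  {i : Fin K → Bool}

/-- The squared norm drifts by at most -γL + 2Kη + 2∑ 1/(χx). Dividing by 2L gives -γ/2 plus a term
that is at most γ/4 once L exceeds `driftLevel`. -/
lemma integral_weightedNorm_nextAge_sub_le (hB : IsRequestProcess P p B)
    (hWm : ∀ j, Measurable (noise X S B j)) (hW : iIndepFun (noise X S B) P)
    (hp : ∀ k, p k ∈ Set.Ioc (0 : ℝ) 1) (hx : ∀ k, x k ∈ Set.Ioc (0 : ℝ) 1)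
    (hχ : ∀ k, 0 < χ k) (hχp : ∀ k, χ k ≤ p k) (hγ : 0 < γ) (hη : 0 < η)
    (hXx : ∀ k, ∫ ω, ((X k (S t ω)).toNat : ℝ) ∂P = x k) (hz : ∀ k, z k < t)
    (hdrift : ∑ k, p k / x k * (z k : ℝ) - ∑ k, (z k : ℝ) * ((i k).toNat : ℝ) ≤
      -(γ / 2) * ∑ k, (z k : ℝ) / x k + K * η)
    (hL : driftLevel x χ γ η ≤ weightedNorm (fun k => p k / x k) (fun k => (z k : ℝ))) :
    ∫ ω, (weightedNorm (fun k => p k / x k) (fun k => nextAge X S B t z i k ω)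
      - weightedNorm (fun k => p k / x k) (fun k => (z k : ℝ))) ∂P ≤ -(γ / 4) := by
  set w : Fin K → ℝ := fun k => p k / x k with hwdef
  have hw : ∀ k, 0 ≤ w k := fun k => div_nonneg (hp k).1.le (hx k).1.le
  set L := weightedNorm w (fun k => (z k : ℝ)) with hLdef
  have hL0 : 0 < L := (driftLevel_pos hx hχ hγ hη).trans_le hL
  have hdet := DeterminedBy.of_forall fun k => determinedBy_nextAge X S B hz i k
  have hV : ∫ ω, weightedNorm w (fun k => nextAge X S B t z i k ω) ^ 2 ∂P ≤
      L ^ 2 - γ * L + 2 * (K * η) + 2 * ∑ k, 1 / (χ k * x k) := by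
    simp only [weightedNorm_sq hw]
    rw [integral_finsetSum _ fun k _ =>
      ((determinedBy_nextAge X S B hz i k).comp fun a => w k * a ^ 2).integrable hWm]
    simp only [integral_const_mul]
    -- Since p ≤ 1 and x ≤ 1, the weight √(p/x) is at most 1/x; this converts the drift in the ages
    -- into a drift in L.
    have h1 : L ≤ ∑ k, (z k : ℝ) / x k := by
      refine (weightedNorm_le_sum _ _).trans (Finset.sum_le_sum fun k _ => ?_)
      obtain ⟨hx0, hx1⟩ := hx k
      rw [abs_of_nonneg (Nat.cast_nonneg _), div_eq_mul_one_div, mul_comm]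
      refine mul_le_mul_of_nonneg_left (Real.sqrt_le_iff.2 ⟨by positivity, ?_⟩) (Nat.cast_nonneg _)
      rw [hwdef, div_pow, div_le_div_iff₀ hx0 (by positivity)]
      nlinarith [(hp k).1, (hp k).2, mul_nonneg hx0.le hx0.le]
    have h2 : ∑ k, 2 / (p k * x k) ≤ 2 * ∑ k, 1 / (χ k * x k) := by
      rw [Finset.mul_sum]
      refine Finset.sum_le_sum fun k _ => ?_
      rw [mul_one_div]
      exact div_le_div_of_nonneg_left (by norm_num) (mul_pos (hχ k) (hx k).1)
        (mul_le_mul_of_nonneg_right (hχp k) (hx k).1.le)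
    have h3 := Finset.sum_le_sum fun k (_ : k ∈ Finset.univ) =>
      integral_nextAge_sq_le (i := i) hB hWm hW hp hx hXx hz k
    rw [Finset.sum_add_distrib, Finset.sum_add_distrib, ← Finset.mul_sum,
      Finset.sum_sub_distrib] at h3
    rw [hLdef, weightedNorm_sq hw, ← hLdef]
    nlinarith
  have hint1 : Integrable (fun ω => weightedNorm w (fun k => nextAge X S B t z i k ω) - L) P :=
    (hdet.comp fun v => weightedNorm w v - L).integrable hWm
  have hint2 : Integrable (fun ω => weightedNorm w (fun k => nextAge X S B t z i k ω) ^ 2) P :=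
    (hdet.comp fun v => weightedNorm w v ^ 2).integrable hWm
  -- Concavity of the square root transfers the drift of L² to L.
  have hle : ∀ ω, weightedNorm w (fun k => nextAge X S B t z i k ω) - L ≤
      (weightedNorm w (fun k => nextAge X S B t z i k ω) ^ 2 - L ^ 2) / (2 * L) := fun ω => by
    rw [le_div_iff₀ (by positivity)]
    nlinarith [sq_nonneg (weightedNorm w (fun k => nextAge X S B t z i k ω) - L)]
  refine (integral_mono hint1 ((hint2.sub (integrable_const _)).div_const _) hle).trans ?_
  simp only [Pi.sub_apply]
  rw [integral_div, integral_sub hint2 (integrable_const _), div_le_iff₀ (by positivity)]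
  simp only [integral_const, probReal_univ, one_smul]
  have h4 : 4 * ∑ k, 1 / (χ k * x k) + 4 * (K * η) ≤ γ * L := by
    refine le_trans (le_of_eq ?_) (mul_le_mul_of_nonneg_left hL hγ.le)
    rw [driftLevel]
    field_simp
  linarith

/-- Above the drift level the exponential contracts; below it, the current value is at most its
value at that level and the exponential moment of the increment costs a factor g. Adding the two
bounds avoids a case distinction later. -/
lemma integral_exp_weightedNorm_nextAge_le (hB : IsRequestProcess P p B)
    (hWm : ∀ j, Measurable (noise X S B j)) (hW : iIndepFun (noise X S B) P)
    (hp : ∀ k, p k ∈ Set.Ioc (0 : ℝ) 1) (hx : ∀ k, x k ∈ Set.Ioc (0 : ℝ) 1)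
    (hχ : ∀ k, χ k ∈ Set.Ioc (0 : ℝ) 1) (hχp : ∀ k, χ k ≤ p k) (hγ : γ ∈ Set.Ioc (0 : ℝ) 1)
    (hη : 0 < η) (hθ : θ ∈ thetaRange x χ)
    (hXx : ∀ k, ∫ ω, ((X k (S t ω)).toNat : ℝ) ∂P = x k) (hz : ∀ k, z k < t)
    (hdrift : ∑ k, p k / x k * (z k : ℝ) - ∑ k, (z k : ℝ) * ((i k).toNat : ℝ) ≤
      -(γ / 2) * ∑ k, (z k : ℝ) / x k + K * η) :
    ∫ ω, Real.exp (lyapunovRate x χ γ θ *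
      weightedNorm (fun k => p k / x k) (fun k => nextAge X S B t z i k ω)) ∂P ≤
    (1 - lyapunovRate x χ γ θ * γ / 8) * Real.exp (lyapunovRate x χ γ θ *
      weightedNorm (fun k => p k / x k) (fun k => (z k : ℝ)))
      + Real.exp (lyapunovRate x χ γ θ * driftLevel x χ γ η) * gProd x χ θ := by
  have hχ1 : ∀ k, χ k ≤ 1 := fun k => (hχ k).2
  have hr0 := lyapunovRate_pos hx hχ1 hγ.1 hθ
  have hrθ := lyapunovRate_le hx hχ1 hγ hθ
  have hr1 := lyapunovRate_le_one hx hχ1 hγ hθ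
  have hg1 := one_le_gProd hx hχ1 hθ
  have hθ0 := hθ.1
  have hrdef : lyapunovRate x χ γ θ = γ * θ ^ 2 / (8 * gProd x χ θ) := rfl
  have hpθ : ∀ k, (1 - p k) * Real.exp (2 * θ / x k) < 1 := fun k =>
    (mul_le_mul_of_nonneg_right (by linarith [hχp k]) (Real.exp_pos _).le).trans_lt (hθ.2.2 k)
  have hmgf := integral_exp_nextAge_le (i := i) hB hWm hW hp hx hz hθ0.le hpθ
  have hgle : gProd x p θ ≤ gProd x χ θ := by
    rw [gProd_eq_prod_geometricMGF, gProd_eq_prod_geometricMGF]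
    have hu : ∀ k, 0 ≤ 2 * θ / x k := fun k => div_nonneg (by linarith) (hx k).1.le
    exact Finset.prod_le_prod
      (fun k _ => zero_le_one.trans (one_le_geometricMGF (hp k).2 (hu k) (hpθ k)))
      fun k _ => geometricMGF_anti (hχp k) (hu k) (hθ.2.2 k)
  replace hmgf := hmgf.trans hgle
  have hdr := integral_weightedNorm_nextAge_sub_le (i := i) hB hWm hW hp hx (fun k => (hχ k).1)
    hχp hγ.1 hη hXx hz hdrift
  have hdet := DeterminedBy.of_forall fun k => determinedBy_nextAge X S B hz i k
  set w : Fin K → ℝ := fun k => p k / x k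
  set L := weightedNorm w (fun k => (z k : ℝ))
  set r := lyapunovRate x χ γ θ
  set g := gProd x χ θ
  have hexp : Integrable (fun ω => Real.exp (2 * θ *
      |weightedNorm w (fun k => nextAge X S B t z i k ω) - L|)) P :=
    (hdet.comp fun v => Real.exp (2 * θ * |weightedNorm w v - L|)).integrable hWm
  rcases le_or_gt (driftLevel x χ γ η) L with hL | hL
  · have hrs : r = r / (2 * θ) * (2 * θ) := by field_simp
    have h1 := integral_exp_mul_le (s := r / (2 * θ)) (θ := 2 * θ) (by positivity)
      (by rw [div_le_iff₀ (by positivity)]; linarith) (by positivity)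
      ((hdet.comp fun v => weightedNorm w v - L).integrable hWm)
      ((hdet.comp fun v => Real.exp (r / (2 * θ) * (2 * θ * (weightedNorm w v - L)))).integrable
        hWm) hexp hmgf (hdr hL)
    -- The rate r is chosen so that r g / θ² = γ/8: the quadratic term consumes half of the linear
    -- gain rγ/4.
    have h2 : 1 - r / (2 * θ) * (2 * θ) * (γ / 4) + 4 * (r / (2 * θ)) ^ 2 * g = 1 - r * γ / 8 := by
      rw [← hrs]
      have : 4 * (r / (2 * θ)) ^ 2 * g = r * (r * g / θ ^ 2) := by
        field_simp
        ring
      have h3 : r * g / θ ^ 2 = γ / 8 := by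
        rw [hrdef]
        field_simp
      rw [this, h3]
      ring
    rw [h2] at h1
    have h3 : ∀ ω, Real.exp (r * weightedNorm w (fun k => nextAge X S B t z i k ω)) =
        Real.exp (r / (2 * θ) * (2 * θ *
          (weightedNorm w (fun k => nextAge X S B t z i k ω) - L))) * Real.exp (r * L) := by
      intro ω
      rw [← Real.exp_add, ← mul_assoc, ← hrs]
      ring_nf
    simp only [h3]
    rw [integral_mul_const]
    have := mul_le_mul_of_nonneg_right h1 (Real.exp_pos (r * L)).le
    have : 0 ≤ Real.exp (r * driftLevel x χ γ η) * g := by positivity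
    linarith
  · have h1 : ∫ ω, Real.exp (r * weightedNorm w (fun k => nextAge X S B t z i k ω)) ∂P ≤
        ∫ ω, Real.exp (r * driftLevel x χ γ η) * Real.exp (2 * θ *
          |weightedNorm w (fun k => nextAge X S B t z i k ω) - L|) ∂P := by
      refine integral_mono_of_nonneg (Filter.Eventually.of_forall fun ω => (Real.exp_pos _).le)
        (hexp.const_mul _) (Filter.Eventually.of_forall fun ω => ?_)
      dsimp only
      rw [← Real.exp_add, Real.exp_le_exp]
      have h2 := le_abs_self (weightedNorm w (fun k => nextAge X S B t z i k ω) - L)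
      have h3 := abs_nonneg (weightedNorm w (fun k => nextAge X S B t z i k ω) - L)
      nlinarith
    rw [integral_const_mul] at h1
    have h2 := mul_le_mul_of_nonneg_left hmgf (Real.exp_pos (r * driftLevel x χ γ η)).le
    have h3 : 0 ≤ (1 - r * γ / 8) * Real.exp (r * L) :=
      mul_nonneg (by nlinarith [hγ.1, hγ.2]) (Real.exp_pos _).le
    linarith

end OneStep

/-! ### Comparison with the static Slater policy -/

section Slater

variable {K : ℕ} {𝒮 𝒜 Ω : Type*} {X : Fin K → 𝒮 → Bool} {I : Fin K → 𝒜 → Bool}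
  {S : ℕ → Ω → 𝒮} {B : Fin K → ℕ → Ω → Bool} {A : ℕ → Ω → 𝒜} {η : ℝ}

/-- The frequency at which the static policy `σ` schedules arm `k`. -/
def scheduleRate (I : Fin K → 𝒜 → Bool) (σ : PMF 𝒜) (k : Fin K) : ℝ :=
  ∑' a, (σ a).toReal * ((I k a).toNat : ℝ)

lemma hasSum_toReal (σ : PMF 𝒜) : HasSum (fun a => (σ a).toReal) 1 := by
  have h := (ENNReal.summable_toReal σ.tsum_coe_ne_top).hasSum
  rwa [← ENNReal.tsum_toReal_eq σ.apply_ne_top, σ.tsum_coe, ENNReal.toReal_one] at h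

lemma hasSum_scheduleRate (I : Fin K → 𝒜 → Bool) (σ : PMF 𝒜) (k : Fin K) :
    HasSum (fun a => (σ a).toReal * ((I k a).toNat : ℝ)) (scheduleRate I σ k) := by
  refine (Summable.of_nonneg_of_le (fun a => by positivity) (fun a => ?_)
    (hasSum_toReal σ).summable).hasSum
  exact mul_le_of_le_one_right ENNReal.toReal_nonneg (by cases I k a <;> simp)

lemma scheduleRate_mem_Icc (I : Fin K → 𝒜 → Bool) (σ : PMF 𝒜) (k : Fin K) :
    scheduleRate I σ k ∈ Set.Icc (0 : ℝ) 1 :=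
  ⟨(hasSum_scheduleRate I σ k).nonneg fun a => by positivity,
    hasSum_le (fun a => mul_le_of_le_one_right ENNReal.toReal_nonneg (by cases I k a <;> simp))
      (hasSum_scheduleRate I σ k) (hasSum_toReal σ)⟩

/-- An average over actions is at most any uniform upper bound; it is applied with the maximal
score. -/
lemma sum_mul_scheduleRate_le (σ : PMF 𝒜) {c : Fin K → ℝ} {M : ℝ}
    (h : ∀ a, ∑ k, c k * ((I k a).toNat : ℝ) ≤ M) : ∑ k, c k * scheduleRate I σ k ≤ M := by
  have h1 : HasSum (fun a => ∑ k, c k * ((σ a).toReal * ((I k a).toNat : ℝ)))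
      (∑ k, c k * scheduleRate I σ k) :=
    hasSum_sum fun k _ => (hasSum_scheduleRate I σ k).mul_left (c k)
  have h2 := (hasSum_toReal σ).mul_right M
  rw [one_mul] at h2
  refine hasSum_le (fun a => ?_) h1 h2
  refine le_trans (le_of_eq ?_) (mul_le_mul_of_nonneg_left (h a) ENNReal.toReal_nonneg)
  rw [Finset.mul_sum]
  exact Finset.sum_congr rfl fun k _ => by ring

/-- The action of the algorithm serves the ages almost as well as a static policy. -/
lemma sum_age_mul_scheduleRate_le [MeasurableSpace 𝒜] (hA : IsAgeBasedLearning X I S B η A)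
    (hη : 0 ≤ η) (σ : PMF 𝒜) {t : ℕ} (ht : 1 ≤ t) (ω : Ω) :
    ∑ k, (age X I S B A k t ω : ℝ) * scheduleRate I σ k ≤
      ∑ k, (age X I S B A k t ω : ℝ) * ((I k (A t ω)).toNat : ℝ) + K * η := by
  have h := sum_mul_scheduleRate_le σ (hA.argmax t ht ω)
  simp only [score, add_mul, Finset.sum_add_distrib] at h
  -- The UCB terms of the two policies differ by at most η per arm, because the estimates and the
  -- scheduling frequencies lie in [0, 1].
  have h1 : ∑ k, η * ucbEstimate X I S A k t ω * ((I k (A t ω)).toNat : ℝ) ≤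
      ∑ k, (η * ucbEstimate X I S A k t ω * scheduleRate I σ k + η) := by
    refine Finset.sum_le_sum fun k _ => ?_
    have hU : ucbEstimate X I S A k t ω ∈ Set.Icc (0 : ℝ) 1 := ucb_mem_Icc _ _ _
    have hs := (scheduleRate_mem_Icc I σ k).1
    have h2 : ((I k (A t ω)).toNat : ℝ) ≤ 1 := by cases I k (A t ω) <;> simp
    have h3 : η * ucbEstimate X I S A k t ω ≤ η := mul_le_of_le_one_right hη hU.2
    have h4 : 0 ≤ η * ucbEstimate X I S A k t ω := mul_nonneg hη hU.1
    have h5 := mul_nonneg h4 hs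
    have h6 : η * ucbEstimate X I S A k t ω * ((I k (A t ω)).toNat : ℝ) ≤
        η * ucbEstimate X I S A k t ω := mul_le_of_le_one_right h4 h2
    linarith
  rw [Finset.sum_add_distrib, Finset.sum_const, Finset.card_univ, Fintype.card_fin,
    nsmul_eq_mul] at h1
  linarith

end Slater

/-! ### Channel rates and the consequences of Slater's condition -/

section Rates

variable {K : ℕ} {𝒮 𝒜 Ω : Type*} [MeasurableSpace Ω] {P : Measure Ω}
  {X : Fin K → 𝒮 → Bool} {I : Fin K → 𝒜 → Bool} {S : ℕ → Ω → 𝒮}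
  {χ : Fin K → ℝ} {γ : ℝ}

lemma integral_state_eq_channelRate [MeasurableSpace 𝒮] (hX : ∀ k, Measurable (X k))
    (hS : IsIIDNetwork P S) {t : ℕ} (ht : 1 ≤ t) (k : Fin K) :
    ∫ ω, ((X k (S t ω)).toNat : ℝ) ∂P = channelRate P X S k :=
  ((hS.identDistrib t ht).comp
    ((measurable_of_finite fun b : Bool => (b.toNat : ℝ)).comp (hX k))).integral_eq

lemma channelRate_mem_Icc (P : Measure Ω) [IsProbabilityMeasure P] (X : Fin K → 𝒮 → Bool)
    (S : ℕ → Ω → 𝒮) (k : Fin K) : channelRate P X S k ∈ Set.Icc (0 : ℝ) 1 := by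
  refine ⟨integral_nonneg fun ω => by positivity, ?_⟩
  have h := integral_mono_of_nonneg (μ := P) (f := fun ω => ((X k (S 1 ω)).toNat : ℝ))
    (g := fun _ => (1 : ℝ)) (Filter.Eventually.of_forall fun ω => by positivity)
    (integrable_const _) (Filter.Eventually.of_forall fun ω => by
      cases h : X k (S 1 ω) <;> simp [h])
  rw [channelRate]
  simpa using h

/-- Scheduling frequencies and channel rates are at most 1. Hence the slack γ leaves room for χ < 1
and for a request probability χ + ε ≤ 1. -/
lemma IsTight.channelRate_pos_and_le [IsProbabilityMeasure P] {σ : PMF 𝒜}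
    (hχ : ∀ k, χ k ∈ Set.Ioc (0 : ℝ) 1) (hγ : 0 < γ)
    (h : IsTight I (channelRate P X S) χ γ σ) (k : Fin K) :
    0 < channelRate P X S k ∧ χ k + γ ≤ 1 := by
  have hx := channelRate_mem_Icc P X S k
  have hs := scheduleRate_mem_Icc I σ k
  have hk : χ k + γ ≤ channelRate P X S k * scheduleRate I σ k := h k
  have hle : channelRate P X S k * scheduleRate I σ k ≤ channelRate P X S k :=
    mul_le_of_le_one_right hx.1 hs.2
  have := (hχ k).1
  exact ⟨by linarith, by linarith [hx.2]⟩

end Rates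

/-! ### Conditioning on the ages and scheduled arms of a slot -/

section Dynamics

variable {K : ℕ} {𝒮 𝒜 Ω : Type*}
  {X : Fin K → 𝒮 → Bool} {I : Fin K → 𝒜 → Bool}
  {S : ℕ → Ω → 𝒮} {B : Fin K → ℕ → Ω → Bool} {A : ℕ → Ω → 𝒜} {η : ℝ}

lemma age_succ_le_nextAge (t : ℕ+) (ω : Ω) (k : Fin K) :
    (age X I S B A k (t + 1) ω : ℝ) ≤
      nextAge X S B t (fun k => age X I S B A k t ω) (fun k => I k (A t ω)) k ω := by
  have h : age X I S B A k (t + 1) ω ≤ age X I S B A k t ω + 1 -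
      (reward X I S A k ω t).toNat * nextWait B t (fun k => age X I S B A k t ω) k ω :=
    headOfLineAge_succ_le _ _ t.pos
  have h1 : (reward X I S A k ω t).toNat * nextWait B t (fun k => age X I S B A k t ω) k ω ≤
      age X I S B A k t ω + 1 := by
    have : nextWait B t (fun k => age X I S B A k t ω) k ω ≤ age X I S B A k t ω + 1 :=
      waitTime_le _ _ _
    cases reward X I S A k ω t <;> simp [this]
  have h2 : age X I S B A k (t + 1) ω +
      (reward X I S A k ω t).toNat * nextWait B t (fun k => age X I S B A k t ω) k ω ≤
      age X I S B A k t ω + 1 := by omega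
  have h3 : (age X I S B A k (t + 1) ω : ℝ) +
      ((reward X I S A k ω t).toNat : ℝ) * nextWait B t (fun k => age X I S B A k t ω) k ω ≤
      (age X I S B A k t ω : ℝ) + 1 := by exact_mod_cast h2
  rw [reward] at h3
  rw [nextAge]
  linarith

variable [MeasurableSpace 𝒜] [MeasurableSingletonClass 𝒜]

lemma history_congr_of_noise (hA : IsAgeBasedLearning X I S B η A) (t : ℕ+) {m : Fin K → ℕ}
    {ω ω' : Ω} (hm : ∀ k, t - age X I S B A k t ω ≤ m k)
    (h : ∀ j ∈ pastNoise (t : ℕ) m, noise X S B j ω = noise X S B j ω') :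
    A t ω = A t ω' ∧ ∀ k, age X I S B A k t ω = age X I S B A k t ω' := by
  refine history_congr hA t.pos ?_ ?_ t.pos le_rfl
  · intro k s h1 h2
    exact congrFun (h (.inl ⟨s, h1⟩) (inl_mem_pastNoise.2 h2)) k
  · intro k u h1 h2
    exact congrFun (h (.inr (k, ⟨u, h1⟩)) (inr_mem_pastNoise.2
      ⟨h2.trans (Nat.sub_le _ _), h2.trans (hm k)⟩)) k

/-- The ages and the set of scheduled arms in slot `t`. -/
def snapshot (X : Fin K → 𝒮 → Bool) (I : Fin K → 𝒜 → Bool) (S : ℕ → Ω → 𝒮)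
    (B : Fin K → ℕ → Ω → Bool) (A : ℕ → Ω → 𝒜) (t : ℕ+) (ω : Ω) :
    (Fin K → Fin t) × (Fin K → Bool) :=
  (fun k => ⟨age X I S B A k t ω, headOfLineAge_lt _ _ t.pos⟩, fun k => I k (A t ω))

lemma determinedBy_snapshot (hA : IsAgeBasedLearning X I S B η A) (t : ℕ+) :
    DeterminedBy (noise X S B) (pastNoise (t : ℕ) fun _ => t) (snapshot X I S B A t) := by
  intro ω ω' h
  obtain ⟨h1, h2⟩ := history_congr_of_noise hA t (fun k => Nat.sub_le _ _) h
  simp only [snapshot, h1, h2]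

-- The value q itself fixes which requests are needed: on the event, the ages are those of q, so
-- only requests up to the slots t minus these ages matter. This is the stopping-time property that
-- leaves the later requests fresh.
open Classical in
lemma determinedBy_snapshot_eq (hA : IsAgeBasedLearning X I S B η A) (t : ℕ+)
    (q : (Fin K → Fin t) × (Fin K → Bool)) :
    DeterminedBy (noise X S B) (pastNoise (t : ℕ) fun k => t - q.1 k)
      (fun ω => if snapshot X I S B A t ω = q then (1 : ℝ) else 0) := by
  have key : ∀ ω ω', (∀ j ∈ pastNoise (t : ℕ) (fun k => t - q.1 k),
      noise X S B j ω = noise X S B j ω') → snapshot X I S B A t ω = q →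
      snapshot X I S B A t ω' = q := by
    intro ω ω' h hq
    obtain ⟨h1, h2⟩ := history_congr_of_noise hA t (fun k => by rw [← hq]; exact le_rfl) h
    rw [← hq]
    simp only [snapshot, h1, h2]
  intro ω ω' h
  have : snapshot X I S B A t ω = q ↔ snapshot X I S B A t ω' = q :=
    ⟨key ω ω' h, key ω' ω fun j hj => (h j hj).symm⟩
  simp only [this]

variable [MeasurableSpace Ω] {P : Measure Ω} [IsProbabilityMeasure P]

open Classical in
/-- Conditioning on the ages and the scheduled arms of slot `t`. -/
lemma integral_le_integral_snapshot (hA : IsAgeBasedLearning X I S B η A)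
    (hWm : ∀ j, Measurable (noise X S B j)) (hW : iIndepFun (noise X S B) P) (t : ℕ+)
    {F : Ω → ℝ} (hF : ∀ ω, 0 ≤ F ω) (G : (Fin K → Fin t) × (Fin K → Bool) → Ω → ℝ)
    (c : (Fin K → Fin t) × (Fin K → Bool) → ℝ)
    (hG : ∀ q, DeterminedBy (noise X S B) (freshNoise t fun k => q.1 k) (G q))
    (hFG : ∀ ω, F ω ≤ G (snapshot X I S B A t ω) ω)
    (hc : ∀ ω, ∫ ω', G (snapshot X I S B A t ω) ω' ∂P ≤ c (snapshot X I S B A t ω)) :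
    ∫ ω, F ω ∂P ≤ ∫ ω, c (snapshot X I S B A t ω) ∂P := by
  set H := snapshot X I S B A t
  have hind := determinedBy_snapshot_eq hA t
  have hdis := fun q : (Fin K → Fin t) × (Fin K → Bool) =>
    disjoint_pastNoise_freshNoise t fun k => (q.1 k : ℕ)
  have hint : ∀ q, Integrable (fun ω => (if H ω = q then (1 : ℝ) else 0) * G q ω) P := fun q =>
    (((hind q).mono Finset.subset_union_left).comp₂ ((hG q).mono Finset.subset_union_right)
      fun a b => a * b).integrable hWm
  have h1 : ∫ ω, F ω ∂P ≤ ∫ ω, ∑ q, (if H ω = q then (1 : ℝ) else 0) * G q ω ∂P := by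
    refine integral_mono_of_nonneg (Filter.Eventually.of_forall hF)
      (integrable_finsetSum _ fun q _ => hint q) (Filter.Eventually.of_forall fun ω => ?_)
    simpa using hFG ω
  refine h1.trans ?_
  rw [integral_finsetSum _ fun q _ => hint q]
  have h2 : ∀ ω, c (H ω) = ∑ q, (if H ω = q then (1 : ℝ) else 0) * c q := fun ω => by simp
  simp only [h2]
  rw [integral_finsetSum _ fun q _ => ((hind q).integrable hWm).mul_const _]
  refine Finset.sum_le_sum fun q _ => ?_
  rw [(hind q).integral_mul (hG q) (hdis q) hWm hW, integral_mul_const]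
  -- The conditional bound is assumed only for attained values; for the others the indicator
  -- vanishes.
  by_cases hq : ∃ ω, H ω = q
  · obtain ⟨ω, rfl⟩ := hq
    exact mul_le_mul_of_nonneg_left (hc ω)
      (integral_nonneg fun ω' => by dsimp only [Pi.zero_apply]; split_ifs <;> norm_num)
  · have hq' : ∀ ω, snapshot X I S B A t ω ≠ q := fun ω h => hq ⟨ω, h⟩
    simp [hq']

end Dynamics

/-! ### Comparison of the logarithmic bound with the objective of f -/

section Bounds

variable {K : ℕ} [NeZero K] {x χ : Fin K → ℝ} {γ η θ : ℝ}

/-- The logarithm of the bound for the exponential Lyapunov function, compared with the objective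
that defines `f`. -/
lemma log_div_lyapunovRate_le (hx : ∀ k, x k ∈ Set.Ioc (0 : ℝ) 1) (hχ : ∀ k, χ k ≤ 1)
    (hγ : γ ∈ Set.Ioc (0 : ℝ) 1) (hθ : θ ∈ thetaRange x χ) :
    Real.log (8 * gProd x χ θ / (lyapunovRate x χ γ θ * γ)) / lyapunovRate x χ γ θ ≤
      8 * Real.log (4 / γ) / γ * fObjective x χ θ := by
  have hθ0 := hθ.1
  have hγ0 := hγ.1
  have hg1 := one_le_gProd hx hχ hθ
  have hq1 := one_le_gProd_div_sq hx hχ hθ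
  have hgq := gProd_le_sq hx hχ hθ
  have hlog := one_le_log_gProd hx hχ hθ
  have hΓ : 1 ≤ Real.log (4 / γ) := one_le_log (by rw [le_div_iff₀ hγ0]; linarith [hγ.2])
  rw [fObjective, lyapunovRate]
  rw [mul_div_assoc] at hlog ⊢
  set g := gProd x χ θ
  have hq0 : 0 < g / θ ^ 2 := by linarith
  have e1 : 8 * g / (γ * θ ^ 2 / (8 * g) * γ) = (4 / γ) ^ 2 * (4 * (g / θ ^ 2) * g) := by
    field_simp
    norm_num
  have e2 : Real.log (4 * (g / θ ^ 2) * g) ≤ 3 * Real.log (32 * (g / θ ^ 2)) := by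
    have : 3 * Real.log (32 * (g / θ ^ 2)) = Real.log ((32 * (g / θ ^ 2)) ^ 3) := by
      rw [Real.log_pow]; norm_num
    rw [this]
    refine Real.log_le_log (by positivity) ?_
    generalize g / θ ^ 2 = q at *
    calc 4 * q * g ≤ 4 * q * q ^ 2 := by gcongr
      _ ≤ (32 * q) ^ 3 := by nlinarith [pow_pos hq0 3]
  -- Both logarithms on the right are at least 1, so 2 log(4/γ) + 3 log(32 g/θ²) is at most 5 times
  -- their product; the factor 9 leaves slack.
  have e3 : Real.log (8 * (g / (γ * θ ^ 2 / (8 * g) * γ))) ≤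
      9 * (Real.log (4 / γ) * Real.log (32 * (g / θ ^ 2))) := by
    rw [← mul_div_assoc, e1, Real.log_mul (by positivity) (by positivity), Real.log_pow]
    push_cast
    nlinarith
  have hr : 0 < γ * θ ^ 2 / (8 * g) := by positivity
  rw [div_le_iff₀ hr]
  refine e3.trans (le_of_eq ?_)
  rw [mul_div_assoc 32]
  field_simp

end Bounds

/-! ### Assembling the drift and the moment bound -/

section Main

variable {K : ℕ} {𝒮 𝒜 Ω : Type*} [MeasurableSpace 𝒜] {X : Fin K → 𝒮 → Bool}
  {I : Fin K → 𝒜 → Bool} {χ x : Fin K → ℝ} {γ ε η θ : ℝ} {S : ℕ → Ω → 𝒮}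
  {B : Fin K → ℕ → Ω → Bool} {A : ℕ → Ω → 𝒜}

/-- The drift condition holds in every slot. -/
lemma sum_age_drift_le (hA : IsAgeBasedLearning X I S B η A) (hη : 0 ≤ η)
    (hx : ∀ k, 0 < x k) (hε : ε ≤ γ / 2) {σ : PMF 𝒜} (hσ : IsTight I x χ γ σ)
    {t : ℕ} (ht : 1 ≤ t) (ω : Ω) :
    ∑ k, (χ k + ε) / x k * (age X I S B A k t ω : ℝ) -
      ∑ k, (age X I S B A k t ω : ℝ) * ((I k (A t ω)).toNat : ℝ) ≤
      -(γ / 2) * ∑ k, (age X I S B A k t ω : ℝ) / x k + K * η := by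
  have h := sum_age_mul_scheduleRate_le hA hη σ ht ω
  have h1 : ∑ k, (χ k + ε) / x k * (age X I S B A k t ω : ℝ) ≤
      ∑ k, ((age X I S B A k t ω : ℝ) * scheduleRate I σ k +
        -(γ / 2) * ((age X I S B A k t ω : ℝ) / x k)) := by
    refine Finset.sum_le_sum fun k _ => ?_
    have hk : χ k + γ ≤ x k * scheduleRate I σ k := hσ k
    have h2 : (χ k + γ) / x k ≤ scheduleRate I σ k := by
      rwa [div_le_iff₀ (hx k), mul_comm]
    have h3 : (χ k + ε) / x k ≤ (χ k + γ) / x k - γ / 2 / x k := by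
      rw [← sub_div]
      exact div_le_div_of_nonneg_right (by linarith) (hx k).le
    have h4 := mul_le_mul_of_nonneg_right (h3.trans (sub_le_sub_right h2 _))
      (Nat.cast_nonneg (α := ℝ) (age X I S B A k t ω))
    refine h4.trans (le_of_eq ?_)
    ring
  rw [Finset.sum_add_distrib, ← Finset.mul_sum] at h1
  linarith

variable [MeasurableSingletonClass 𝒜] [MeasurableSpace Ω] {P : Measure Ω} [IsProbabilityMeasure P]

lemma integrable_comp_weightedAgeNorm (hA : IsAgeBasedLearning X I S B η A)
    (hWm : ∀ j, Measurable (noise X S B j)) (x χ : Fin K → ℝ) (ε : ℝ) (φ : ℝ → ℝ) {t : ℕ}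
    (ht : 1 ≤ t) : Integrable (fun ω => φ (weightedAgeNorm X I S B A x χ ε t ω)) P :=
  ((determinedBy_snapshot hA ⟨t, ht⟩).comp fun q =>
    φ (weightedNorm (fun k => (χ k + ε) / x k) fun k => ((q.1 k : ℕ) : ℝ))).integrable hWm

variable [NeZero K] [MeasurableSpace 𝒮]

/-- The exponential Lyapunov function contracts above its drift level. -/
lemma integral_exp_weightedAgeNorm_succ_le (hX : ∀ k, Measurable (X k)) (hS : IsIIDNetwork P S)
    (hB : IsRequestProcess P (fun k => χ k + ε) B)
    (hWm : ∀ j, Measurable (noise X S B j)) (hW : iIndepFun (noise X S B) P)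
    (hA : IsAgeBasedLearning X I S B η A) (hη : 0 < η)
    (hx : ∀ k, channelRate P X S k ∈ Set.Ioc (0 : ℝ) 1) (hχ : ∀ k, χ k ∈ Set.Ioc (0 : ℝ) 1)
    (hγ : γ ∈ Set.Ioc (0 : ℝ) 1) (hε : ε ∈ Set.Ioc (0 : ℝ) (γ / 2)) (hp : ∀ k, χ k + ε ≤ 1)
    {σ : PMF 𝒜} (hσ : IsTight I (channelRate P X S) χ γ σ)
    (hθ : θ ∈ thetaRange (channelRate P X S) χ) {r : ℝ}
    (hr : r = lyapunovRate (channelRate P X S) χ γ θ) {t : ℕ} (ht : 1 ≤ t) :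
    ∫ ω, Real.exp (r * weightedAgeNorm X I S B A (channelRate P X S) χ ε (t + 1) ω) ∂P ≤
      (1 - r * γ / 8) *
        ∫ ω, Real.exp (r * weightedAgeNorm X I S B A (channelRate P X S) χ ε t ω) ∂P
      + Real.exp (r * driftLevel (channelRate P X S) χ γ η) *
        gProd (channelRate P X S) χ θ := by
  set x := channelRate P X S with hxdef
  have hr0 : 0 < r := hr ▸ lyapunovRate_pos hx (fun k => (hχ k).2) hγ.1 hθ
  have hw : ∀ k, 0 ≤ (χ k + ε) / x k := fun k =>
    div_nonneg (add_nonneg (hχ k).1.le hε.1.le) (hx k).1.le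
  have h1 := integral_le_integral_snapshot hA hWm hW ⟨t, ht⟩
    (F := fun ω => Real.exp (r * weightedAgeNorm X I S B A x χ ε (t + 1) ω))
    (fun ω => (Real.exp_pos _).le)
    (fun q ω => Real.exp (r * weightedNorm (fun k => (χ k + ε) / x k)
      (fun k => nextAge X S B t (fun k => q.1 k) q.2 k ω)))
    (fun q => (1 - r * γ / 8) * Real.exp (r * weightedNorm (fun k => (χ k + ε) / x k)
      (fun k => ((q.1 k : ℕ) : ℝ))) + Real.exp (r * driftLevel x χ γ η) * gProd x χ θ)
    (fun q => (DeterminedBy.of_forall fun k => determinedBy_nextAge X S B (t := ⟨t, ht⟩)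
      (z := fun k => q.1 k) (fun k => (q.1 k).2) q.2 k).comp fun v =>
        Real.exp (r * weightedNorm (fun k => (χ k + ε) / x k) v))
    (fun ω => by
      rw [Real.exp_le_exp]
      refine mul_le_mul_of_nonneg_left ?_ hr0.le
      exact weightedNorm_mono hw (fun k => Nat.cast_nonneg _)
        fun k => age_succ_le_nextAge ⟨t, ht⟩ ω k)
    (fun ω => by
      have := integral_exp_weightedNorm_nextAge_le (t := ⟨t, ht⟩) (x := x) (η := η) (γ := γ)
        (z := fun k => age X I S B A k t ω) (i := fun k => I k (A t ω)) hB hWm hW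
        (fun k => ⟨add_pos (hχ k).1 hε.1, hp k⟩) hx hχ (fun k => by linarith [hε.1]) hγ hη hθ
        (integral_state_eq_channelRate hX hS ht) (fun k => headOfLineAge_lt _ _ ht)
        (sum_age_drift_le hA hη.le (fun k => (hx k).1) hε.2 hσ ht ω)
      rw [← hr] at this
      exact this)
  refine h1.trans (le_of_eq ?_)
  have hi : Integrable (fun ω => Real.exp (r * weightedAgeNorm X I S B A x χ ε t ω)) P :=
    integrable_comp_weightedAgeNorm hA hWm x χ ε (fun a => Real.exp (r * a)) ht
  rw [← integral_const_mul]
  refine Eq.trans ?_ ((integral_add (hi.const_mul (1 - r * γ / 8)) (integrable_const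
    (Real.exp (r * driftLevel x χ γ η) * gProd x χ θ))).trans ?_)
  · rfl
  · simp

lemma integral_weightedAgeNorm_le (hX : ∀ k, Measurable (X k)) (hS : IsIIDNetwork P S)
    (hB : IsRequestProcess P (fun k => χ k + ε) B)
    (hWm : ∀ j, Measurable (noise X S B j)) (hW : iIndepFun (noise X S B) P)
    (hA : IsAgeBasedLearning X I S B η A) (hη : 0 < η)
    (hx : ∀ k, channelRate P X S k ∈ Set.Ioc (0 : ℝ) 1) (hχ : ∀ k, χ k ∈ Set.Ioc (0 : ℝ) 1)
    (hγ : γ ∈ Set.Ioc (0 : ℝ) 1) (hε : ε ∈ Set.Ioc (0 : ℝ) (γ / 2)) (hp : ∀ k, χ k + ε ≤ 1)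
    {σ : PMF 𝒜} (hσ : IsTight I (channelRate P X S) χ γ σ)
    (hθ : θ ∈ thetaRange (channelRate P X S) χ) {t : ℕ} (ht : 1 ≤ t) :
    ∫ ω, weightedAgeNorm X I S B A (channelRate P X S) χ ε t ω ∂P ≤
      8 * Real.log (4 / γ) / γ * fObjective (channelRate P X S) χ θ
        + driftLevel (channelRate P X S) χ γ η := by
  have hχ1 : ∀ k, χ k ≤ 1 := fun k => (hχ k).2
  have hr0 := lyapunovRate_pos hx hχ1 hγ.1 hθ
  have hr1 := lyapunovRate_le_one hx hχ1 hγ hθ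
  have hlog := log_div_lyapunovRate_le hx hχ1 hγ hθ
  have hg1 := one_le_gProd hx hχ1 hθ
  have hd0 := driftLevel_pos hx (fun k => (hχ k).1) hγ.1 hη
  have hstep := fun {t} ht => integral_exp_weightedAgeNorm_succ_le (t := t) hX hS hB hWm hW hA hη
    hx hχ hγ hε hp hσ hθ rfl ht
  set x := channelRate P X S with hxdef
  set r := lyapunovRate x χ γ θ
  set g := gProd x χ θ
  have hγ0 := hγ.1
  set M := Real.exp (r * driftLevel x χ γ η) * (8 * g / (r * γ)) with hM
  have hM0 : 0 < M := by positivity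
  have hbound : ∫ ω, Real.exp (r * weightedAgeNorm X I S B A x χ ε t ω) ∂P ≤ M := by
    -- M is the fixed point of the affine recursion in `hstep`, so the bound propagates; it holds in
    -- slot 1 because all ages are 0 there and M ≥ 1.
    induction t, ht using Nat.le_induction with
    | base =>
      have h0 : ∀ ω, weightedAgeNorm X I S B A x χ ε 1 ω = 0 := fun ω => by
        simp [weightedAgeNorm, age, headOfLineAge_one]
        rfl
      simp only [h0, mul_zero, Real.exp_zero, integral_const, probReal_univ, one_smul]
      have h1 : 1 ≤ Real.exp (r * driftLevel x χ γ η) := Real.one_le_exp (by positivity)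
      have h2 : 1 ≤ 8 * g / (r * γ) := by
        rw [one_le_div (by positivity)]
        nlinarith [hγ.2]
      exact one_le_mul_of_one_le_of_one_le h1 h2
    | succ t ht ih =>
      refine (hstep ht).trans ?_
      have h1 : 0 ≤ 1 - r * γ / 8 := by nlinarith [hγ.2]
      refine (add_le_add_left (mul_le_mul_of_nonneg_left ih h1) _).trans (le_of_eq ?_)
      rw [hM]
      field_simp
      ring
  have hi := integrable_comp_weightedAgeNorm (P := P) hA hWm x χ ε id ht
  have hie := integrable_comp_weightedAgeNorm (P := P) hA hWm x χ ε (fun a => Real.exp (r * a)) ht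
  simp only [id] at hi
  -- Jensen's inequality through the tangent line of the exponential at log M.
  have hle : ∀ ω, r * weightedAgeNorm X I S B A x χ ε t ω ≤
      Real.log M - 1 + Real.exp (r * weightedAgeNorm X I S B A x χ ε t ω) / M := fun ω => by
    have := Real.add_one_le_exp (r * weightedAgeNorm X I S B A x χ ε t ω - Real.log M)
    rw [Real.exp_sub, Real.exp_log hM0] at this
    linarith
  have h2 := integral_mono (hi.const_mul r) ((integrable_const _).add (hie.div_const M)) hle
  simp only [Pi.add_apply] at h2
  rw [integral_const_mul, integral_add (integrable_const _) (hie.div_const M), integral_div] at h2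
  simp only [integral_const, probReal_univ, one_smul] at h2
  have h3 := (div_le_one hM0).2 hbound
  have h4 : Real.log M = r * driftLevel x χ γ η + Real.log (8 * g / (r * γ)) := by
    rw [hM, Real.log_mul (Real.exp_pos _).ne' (by positivity), Real.log_exp]
  rw [div_le_iff₀ hr0] at hlog
  rw [← mul_le_mul_iff_right₀ hr0]
  linarith

end Main

end AgeBandit

end

theorem mainTheorem4 {K : ℕ} [NeZero K] {𝒮 𝒜 Ω : Type*}
    [MeasurableSpace 𝒮]
    [Countable 𝒜] [MeasurableSpace 𝒜] [MeasurableSingletonClass 𝒜]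
    [MeasurableSpace Ω] (P : Measure Ω) [IsProbabilityMeasure P]
    (X : Fin K → 𝒮 → Bool) (hX : ∀ k, Measurable (X k))
    (I : Fin K → 𝒜 → Bool)
    (χ : Fin K → ℝ) (hχ : ∀ k, χ k ∈ Set.Ioc (0 : ℝ) 1)
    (γ : ℝ) (hγ : γ ∈ Set.Ioc (0 : ℝ) 1)
    (ε : ℝ) (hε : ε ∈ Set.Ioc (0 : ℝ) (γ / 2))
    (η : ℝ) (hη : 0 < η)
    (S : ℕ → Ω → 𝒮) (hS : AgeBandit.IsIIDNetwork P S)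
    (B : Fin K → ℕ → Ω → Bool) (hB : AgeBandit.IsRequestProcess P (fun k => χ k + ε) B)
    (hSB : IndepFun (fun ω (t : ℕ+) => S t ω) (fun ω (q : Fin K × ℕ+) => B q.1 q.2 ω) P)
    (hSlater : ∃ σ : PMF 𝒜, AgeBandit.IsTight I (AgeBandit.channelRate P X S) χ γ σ)
    (A : ℕ → Ω → 𝒜) (hA : AgeBandit.IsAgeBasedLearning X I S B η A) :
    IsLeast
      (AgeBandit.fObjective (AgeBandit.channelRate P X S) χ ''
        AgeBandit.thetaRange (AgeBandit.channelRate P X S) χ)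
      (AgeBandit.fBound (AgeBandit.channelRate P X S) χ) ∧
    ∀ t : ℕ, 1 ≤ t →
      Integrable
        (AgeBandit.weightedAgeNorm X I S B A (AgeBandit.channelRate P X S) χ ε t) P ∧
      ∫ ω, AgeBandit.weightedAgeNorm X I S B A (AgeBandit.channelRate P X S) χ ε t ω ∂P ≤
        8 * Real.log (4 / γ) / γ * AgeBandit.fBound (AgeBandit.channelRate P X S) χ
          + 4 / γ * ∑ k : Fin K, 1 / (χ k * AgeBandit.channelRate P X S k)
          + 4 * (K : ℝ) * η / γ := by
  obtain ⟨σ, hσ⟩ := hSlater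
  have hWm := AgeBandit.measurable_noise hX hS hB
  have hW := AgeBandit.iIndepFun_noise hX hS hB hSB
  have hpos := hσ.channelRate_pos_and_le hχ hγ.1
  have hx : ∀ k, AgeBandit.channelRate P X S k ∈ Set.Ioc (0 : ℝ) 1 := fun k =>
    ⟨(hpos k).1, (AgeBandit.channelRate_mem_Icc P X S k).2⟩
  have hleast := AgeBandit.isLeast_fBound (x := AgeBandit.channelRate P X S) (y := χ) hx
    fun k => ⟨(hχ k).1, by linarith [(hpos k).2, hγ.1]⟩
  refine ⟨hleast, fun t ht =>
    ⟨AgeBandit.integrable_comp_weightedAgeNorm hA hWm _ χ ε id ht, ?_⟩⟩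
  obtain ⟨θ, hθ, hθf⟩ := hleast.1
  rw [← hθf, add_assoc]
  exact AgeBandit.integral_weightedAgeNorm_le hX hS hB hWm hW hA hη hx hχ hγ hε
    (fun k => by linarith [(hpos k).2, hε.2, hγ.1]) hσ hθ ht
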